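/- All graphs are finite and simple, $\log$ is to base $2$, and $\hom(G)$ denotes the largest size of a clique or an independent set of $G$. A graph $G$ is $H$-free if it has no induced subgraph isomorphic to $H$. A graph $H$ is said to satisfy the Erdős–Hajnal conjecture if there is $\varepsilon>0$ such that $\hom(G)\ge n^{\varepsilon}$ for every $n\ge 1$ and every $H$-free graph $G$ on $n$ vertices. For graphs $H,F$ and a vertex $v$ of $H$, the graph $H_v(F)$ obtained by substitution is the graph that results from replacing $v$ by a copy of $F$, all of whose vertices are joined to the remaining vertices of $H$ in the same manner as $v$. Let $\mathcal S$ be the smallest isomorphism-closed class of graphs that contains the path $P_5$ on five vertices and every graph that satisfies the Erdős–Hajnal conjecture, and that contains $H_v(F)$ whenever it contains $H$ and $F$ and $v$ is a vertex of $H$ (these are the graphs obtained by iterated substitution, using in each step $P_5$ or a graph that satisfies the Erdős–Hajnal conjecture). Then for every $H\in\mathcal S$ there is a constant $c=c(H)>0$ such that every $H$-free graph $G$ on $n\ge 1$ vertices satisfies $$\hom(G)\ \ge\ 2^{c(\log n)^{2/3}} .$$ Moreover, this gives the improved bound for an infinite family of graphs: there are infinitely many positive integers $m$ for which some $m$-vertex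 graph $H\in\mathcal S$ has $P_5$ as an induced subgraph (so that the Erdős–Hajnal conjecture for $H$ would imply it for $P_5$) and satisfies this bound. -/

import Mathlib

/-- `homNumber G` is `hom(G)`, the largest size of a clique or an independent set of `G`. -/
noncomputable def homNumber {V : Type*} (G : SimpleGraph V) : ℕ :=
  max G.cliqueNum G.indepNum

/-- Every `H`-free graph `G` on `n ≥ 1` vertices satisfies `hom(G) ≥ g n`. Here `H`-free means that
`G` has no induced subgraph isomorphic to `H`. -/
def HomBound {W : Type*} (H : SimpleGraph W) (g : ℕ → ℝ) : Prop :=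
  ∀ n : ℕ, 1 ≤ n → ∀ G : SimpleGraph (Fin n), ¬ H.IsIndContained G → g n ≤ (homNumber G : ℝ)

/-- `H` satisfies the Erdős–Hajnal conjecture: for some `ε > 0`, every `H`-free graph on `n`
vertices has a clique or an independent set of size at least `n ^ ε`. -/
def IsErdosHajnal {W : Type*} (H : SimpleGraph W) : Prop :=
  ∃ ε : ℝ, 0 < ε ∧ HomBound H (fun n => (n : ℝ) ^ ε)

/-- The substitution `H_v(F)`: the vertex `v` of `H` is replaced by a copy of `F`, whose vertices
are joined to the remaining vertices of `H` in the same manner as `v`. -/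
def substGraph {V W : Type*} (H : SimpleGraph V) (v : V) (F : SimpleGraph W) :
    SimpleGraph ({u : V // u ≠ v} ⊕ W) where
  Adj
    | .inl a, .inl b => H.Adj a b
    | .inl a, .inr _ => H.Adj a v
    | .inr _, .inl b => H.Adj v b
    | .inr x, .inr y => F.Adj x y
  symm := ⟨by
    rintro (a | x) (b | y) h
    · exact SimpleGraph.Adj.symm h
    · exact SimpleGraph.Adj.symm h
    · exact SimpleGraph.Adj.symm h
    · exact SimpleGraph.Adj.symm h⟩
  loopless := ⟨by
    rintro (a | x) h
    · exact H.loopless.irrefl _ h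
    · exact F.loopless.irrefl _ h⟩

/-- The finite graphs obtained by iterated substitution from `P₅` (the path on five vertices) and
graphs satisfying the Erdős–Hajnal conjecture, up to isomorphism. -/
inductive IteratedSubst : {V : Type} → SimpleGraph V → Prop
  | path : IteratedSubst (SimpleGraph.pathGraph 5)
  | erdosHajnal {V : Type} [Finite V] (H : SimpleGraph V) :
      IsErdosHajnal H → IteratedSubst H
  | subst {V W : Type} (H : SimpleGraph V) (v : V) (F : SimpleGraph W) :
      IteratedSubst H → IteratedSubst F → IteratedSubst (substGraph H v F)
  | iso {V W : Type} (H : SimpleGraph V) (H' : SimpleGraph W) :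
      IteratedSubst H → Nonempty (H ≃g H') → IteratedSubst H'

/-- Every `H`-free graph `G` on `n` vertices satisfies `hom(G) ≥ 2 ^ (Ω((log n) ^ (2/3)))`, with an
implied constant that depends on `H` only. -/
def HasTwoThirdsBound {W : Type*} (H : SimpleGraph W) : Prop :=
  ∃ c : ℝ, 0 < c ∧ HomBound H (fun n => (2 : ℝ) ^ (c * (Real.logb 2 n) ^ ((2 : ℝ) / 3)))

open Finset
-- The class is handled by induction on its construction. Graphs with the Erdős–Hajnal property have
-- a stronger bound. Substitution only costs a constant factor in $\log n$
-- (`HasTwoThirdsBound.substGraph`): if every set of $m$ vertices contains $H$, where $m$ is a small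
-- power of $n$, then by averaging one partial copy of $H - v$ extends in polynomially many ways,
-- and either the set of extensions contains $F$ or the bound for $F$ applies there. The work lies
-- in $P_5$.
--
-- For $P_5$, the product `homProd` of clique and independence numbers is superadditive over
-- complete and over anticomplete pairs. Put $t=(\log n)^{1/3}$, $z=2^t$, $Y=2^{t^2}$,
-- $\kappa=1/(100t)$. Unless there is a clique of size $Y/2$, `PathFiveFree.rpow_le_homProd` shows
-- that a set $S$ whose co-degrees are at most $|S|/y$ has `homProd` at least
-- $(|S|y^2/Y^{34})^\kappa$; the case $y=1$ suffices. In a minimal counterexample all large sets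
-- have large connected and co-connected subsets, and few vertices have much smaller co-degree.
-- `PathFiveFree.exists_pair` then yields a vertex $v$, a connected $P$ and a co-connected $K$, both
-- large, with no $P$–$K$ edges and $v$ complete to $K$, anticomplete to $P$. Neighbours of $v$
-- mixed on $P$ are complete to $K$.
--
-- If $y<z^3$, this gives a complete or anticomplete pair of sets, each a $z^{-O(1)}$ fraction of
-- $S$; passing to such a set costs a factor below 2, so two suffice. If $y\ge z^3$, either almost
-- all of $S$ is complete to $P$ or to $K$, and the small set repays the loss because
-- $2Y^{28\kappa}\le z$, or two sets of proportion $1/z$ are complete to each other.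
/-- `G` has no induced path on five vertices. -/
def PathFiveFree {V : Type*} (G : SimpleGraph V) : Prop :=
  ∀ a b c d e : V, G.Adj a b → G.Adj b c → G.Adj c d → G.Adj d e →
    ¬ G.Adj a c → ¬ G.Adj a d → ¬ G.Adj a e → ¬ G.Adj b d → ¬ G.Adj b e → ¬ G.Adj c e → False

/-! ### The product of clique and independence numbers -/

section CliqueProduct

variable {V : Type*}

open Classical in
/-- The largest size of a clique of `G` inside `S`. -/
noncomputable def cliqueNumOn (G : SimpleGraph V) (S : Finset V) : ℕ :=
  (S.powerset.filter (fun T : Finset V => G.IsClique (T : Set V))).sup card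

/-- The product of the largest sizes of a clique and of an independent set of `G` inside `S`. -/
noncomputable def homProd (G : SimpleGraph V) (S : Finset V) : ℕ :=
  cliqueNumOn G S * cliqueNumOn Gᶜ S

theorem le_cliqueNumOn {G : SimpleGraph V} {S T : Finset V} (hT : T ⊆ S)
    (h : G.IsClique (T : Set V)) : #T ≤ cliqueNumOn G S := by
  classical
  unfold cliqueNumOn
  exact Finset.le_sup (f := card) (by simp [hT, h])

theorem exists_cliqueNumOn_eq (G : SimpleGraph V) (S : Finset V) :
    ∃ T ⊆ S, G.IsClique (T : Set V) ∧ #T = cliqueNumOn G S := by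
  classical
  have hne : (S.powerset.filter (fun T : Finset V => G.IsClique (T : Set V))).Nonempty :=
    ⟨∅, by simp⟩
  obtain ⟨T, hT, h⟩ := Finset.exists_mem_eq_sup _ hne card
  simp only [mem_filter, mem_powerset] at hT
  refine ⟨T, hT.1, hT.2, ?_⟩
  rw [← h]
  unfold cliqueNumOn
  congr!

theorem cliqueNumOn_mono (G : SimpleGraph V) {S T : Finset V} (h : S ⊆ T) :
    cliqueNumOn G S ≤ cliqueNumOn G T := by
  obtain ⟨A, hA, hc, h1⟩ := exists_cliqueNumOn_eq G S
  exact h1 ▸ le_cliqueNumOn (hA.trans h) hc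

theorem homProd_mono (G : SimpleGraph V) {S T : Finset V} (h : S ⊆ T) :
    homProd G S ≤ homProd G T :=
  Nat.mul_le_mul (cliqueNumOn_mono G h) (cliqueNumOn_mono Gᶜ h)

theorem homProd_compl (G : SimpleGraph V) (S : Finset V) : homProd Gᶜ S = homProd G S := by
  simp [homProd, mul_comm]

theorem one_le_cliqueNumOn (G : SimpleGraph V) {S : Finset V} (h : S.Nonempty) :
    1 ≤ cliqueNumOn G S := by
  obtain ⟨x, hx⟩ := h
  have := le_cliqueNumOn (G := G) (S := S) (T := {x}) (by simpa using hx) (by simp)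
  simpa using this

theorem one_le_homProd (G : SimpleGraph V) {S : Finset V} (h : S.Nonempty) :
    1 ≤ homProd G S :=
  Nat.mul_pos (one_le_cliqueNumOn G h) (one_le_cliqueNumOn Gᶜ h)

/-- Clique numbers add over a complete pair, while both independence numbers are at most that of
`U`. Using the product makes the anticomplete case the same statement in the complement. -/
theorem homProd_add_le_of_complete [DecidableEq V] (G : SimpleGraph V) {S T U : Finset V}
    (hS : S ⊆ U) (hT : T ⊆ U)
    (h : ∀ x ∈ S, ∀ y ∈ T, G.Adj x y) : homProd G S + homProd G T ≤ homProd G U := by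
  have h1 : cliqueNumOn G S + cliqueNumOn G T ≤ cliqueNumOn G U := by
    obtain ⟨A, hA, hAc, hA1⟩ := exists_cliqueNumOn_eq G S
    obtain ⟨B, hB, hBc, hB1⟩ := exists_cliqueNumOn_eq G T
    have hd : Disjoint A B := by
      rw [Finset.disjoint_left]
      intro x hx hx'
      exact G.loopless.irrefl x (h x (hA hx) x (hB hx'))
    rw [← hA1, ← hB1, ← card_union_of_disjoint hd]
    refine le_cliqueNumOn (union_subset (hA.trans hS) (hB.trans hT)) ?_
    intro x hx y hy hxy
    simp only [coe_union, Set.mem_union, mem_coe] at hx hy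
    rcases hx with hx | hx <;> rcases hy with hy | hy
    · exact hAc hx hy hxy
    · exact h x (hA hx) y (hB hy)
    · exact (h y (hA hy) x (hB hx)).symm
    · exact hBc hx hy hxy
  have h2 := cliqueNumOn_mono Gᶜ hS
  have h3 := cliqueNumOn_mono Gᶜ hT
  unfold homProd
  calc _ ≤ cliqueNumOn G S * cliqueNumOn Gᶜ U + cliqueNumOn G T * cliqueNumOn Gᶜ U :=
        Nat.add_le_add (Nat.mul_le_mul_left _ h2) (Nat.mul_le_mul_left _ h3)
    _ = (cliqueNumOn G S + cliqueNumOn G T) * cliqueNumOn Gᶜ U := by ring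
    _ ≤ _ := Nat.mul_le_mul_right _ h1

theorem homProd_add_le_of_anticomplete [DecidableEq V] (G : SimpleGraph V) {S T U : Finset V}
    (hS : S ⊆ U) (hT : T ⊆ U) (hd : Disjoint S T)
    (h : ∀ x ∈ S, ∀ y ∈ T, ¬ G.Adj x y) : homProd G S + homProd G T ≤ homProd G U := by
  have := homProd_add_le_of_complete Gᶜ hS hT (fun x hx y hy => by
    rw [SimpleGraph.compl_adj]
    exact ⟨fun hxy => Finset.disjoint_left.1 hd hx (hxy ▸ hy), h x hx y hy⟩)
  simpa [homProd_compl] using this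

end CliqueProduct

/-! ### Connectedness by cuts, and components -/

section Connected

variable {V : Type*}

/-- `C` is nonempty and induces a connected subgraph of `H`, expressed by cuts. -/
def ConnOn (H : SimpleGraph V) (C : Finset V) : Prop :=
  C.Nonempty ∧ ∀ D ⊆ C, D.Nonempty → D ≠ C → ∃ x ∈ D, ∃ y ∈ C, y ∉ D ∧ H.Adj x y

/-- The source of all induced paths below: a vertex mixed on a connected set sees exactly one end of
some edge of that set. -/
theorem ConnOn.exists_adj_of_mixed {H : SimpleGraph V} {C : Finset V} (hC : ConnOn H C)
    (p : V → Prop) {a b : V} (ha : a ∈ C) (hb : b ∈ C) (hpa : p a) (hpb : ¬ p b) :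
    ∃ x ∈ C, ∃ y ∈ C, p x ∧ ¬ p y ∧ H.Adj x y := by
  classical
  obtain ⟨x, hx, y, hy, hyD, hxy⟩ := hC.2 (C.filter p) (filter_subset _ _)
    ⟨a, by simp [ha, hpa]⟩ (fun h => hpb (filter_eq_self.1 h b hb))
  simp only [mem_filter] at hx hyD
  exact ⟨x, hx.1, y, hy, hx.2, fun h => hyD ⟨hy, h⟩, hxy⟩

variable [DecidableEq V]

theorem ConnOn.union {H : SimpleGraph V} {C D : Finset V} (hC : ConnOn H C) (hD : ConnOn H D)
    {a : V} (haC : a ∈ C) (haD : a ∈ D) : ConnOn H (C ∪ D) := by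
  refine ⟨⟨a, by simp [haC]⟩, fun E hE hne h => ?_⟩
  by_cases h1 : (∃ x ∈ C, x ∈ E) ∧ (∃ y ∈ C, y ∉ E)
  · obtain ⟨⟨x, hx, hx'⟩, y, hy, hy'⟩ := h1
    obtain ⟨s, hs, t, ht, hs', ht', hst⟩ := hC.exists_adj_of_mixed (· ∈ E) hx hy hx' hy'
    exact ⟨s, hs', t, by simp [ht], ht', hst⟩
  by_cases h2 : (∃ x ∈ D, x ∈ E) ∧ (∃ y ∈ D, y ∉ E)
  · obtain ⟨⟨x, hx, hx'⟩, y, hy, hy'⟩ := h2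
    obtain ⟨s, hs, t, ht, hs', ht', hst⟩ := hD.exists_adj_of_mixed (· ∈ E) hx hy hx' hy'
    exact ⟨s, hs', t, by simp [ht], ht', hst⟩
  exfalso
  push Not at h1 h2
  by_cases ha : a ∈ E
  · exact h (hE.antisymm (union_subset (h1 ⟨a, haC, ha⟩) (h2 ⟨a, haD, ha⟩)))
  · obtain ⟨x, hx⟩ := hne
    rcases mem_union.1 (hE hx) with hx' | hx'
    · exact ha (h1 ⟨x, hx', hx⟩ a haC)
    · exact ha (h2 ⟨x, hx', hx⟩ a haD)

theorem connOn_pair {H : SimpleGraph V} {a b : V} (h : H.Adj a b) : ConnOn H {a, b} := by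
  refine ⟨by simp, fun D hD hne hD' => ?_⟩
  by_cases ha : a ∈ D
  · by_cases hb : b ∈ D
    · exact absurd (hD.antisymm (by intro x hx; simp at hx; rcases hx with rfl | rfl <;> assumption))
        hD'
    · exact ⟨a, ha, b, by simp, hb, h⟩
  · obtain ⟨x, hx⟩ := hne
    have : x = b := by
      have := hD hx
      simp only [mem_insert, mem_singleton] at this
      rcases this with rfl | h
      · exact absurd hx ha
      · exact h
    exact ⟨b, this ▸ hx, a, by simp, ha, h.symm⟩

/-- Every connected set lies in a connected component of a given set. -/
theorem ConnOn.exists_component {H : SimpleGraph V} {C W : Finset V} (hC : ConnOn H C)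
    (hCW : C ⊆ W) : ∃ K, C ⊆ K ∧ K ⊆ W ∧ ConnOn H K ∧
      ∀ D ⊆ W, ConnOn H D → ∀ x ∈ D, x ∈ K → D ⊆ K := by
  classical
  let F := W.powerset.filter (fun K => C ⊆ K ∧ ConnOn H K)
  have hF : F.Nonempty := ⟨C, by simp [F, hCW, hC]⟩
  obtain ⟨K, hK, hmax⟩ := Finset.exists_max_image F card hF
  simp only [F, mem_filter, mem_powerset] at hK hmax
  refine ⟨K, hK.2.1, hK.1, hK.2.2, fun D hD hDc x hxD hxK => ?_⟩
  have h1 := hmax (K ∪ D) ⟨union_subset hK.1 hD, hK.2.1.trans subset_union_left,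
    hK.2.2.union hDc hxK hxD⟩
  have h2 : K = K ∪ D := Finset.eq_of_subset_of_card_le subset_union_left h1
  rw [h2]
  exact subset_union_right

theorem mem_of_adj_of_component {H : SimpleGraph V} {K W : Finset V}
    (hK : ∀ D ⊆ W, ConnOn H D → ∀ x ∈ D, x ∈ K → D ⊆ K) (hKW : K ⊆ W) {x y : V} (hx : x ∈ K)
    (hy : y ∈ W) (h : H.Adj x y) : y ∈ K := by
  refine hK {x, y} ?_ (connOn_pair h) x (by simp) hx (by simp)
  intro t ht
  simp only [mem_insert, mem_singleton] at ht
  rcases ht with rfl | rfl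
  · exact hKW hx
  · exact hy

/-- If all connected subsets of `W` are small then `homProd G W` is large. -/
theorem homProd_ge_of_small_components (G H : SimpleGraph V) (hGH : H = G ∨ H = Gᶜ) {β κ s : ℝ}
    (hβ : 0 ≤ β) (hκ0 : 0 < κ) (hκ : κ ≤ 1) (W : Finset V)
    (hs : ∀ C ⊆ W, ConnOn H C → (#C : ℝ) ≤ s)
    (hg : ∀ C ⊆ W, ConnOn H C → β * (#C : ℝ) ^ κ ≤ homProd G C) :
    β * #W * s ^ (κ - 1) ≤ homProd G W := by
  classical
  induction hn : #W using Nat.strong_induction_on generalizing W with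
  | _ n ih =>
    rcases W.eq_empty_or_nonempty with rfl | hne
    · simp at hn; subst hn; simp
    by_cases hc : ConnOn H W
    · have hpos : (0 : ℝ) < #W := by exact_mod_cast hne.card_pos
      have h1 := hg W subset_rfl hc
      have h2 := hs W subset_rfl hc
      rw [← hn]
      refine le_trans ?_ h1
      rw [mul_assoc]
      refine mul_le_mul_of_nonneg_left ?_ hβ
      -- Since `κ ≤ 1`, the concave bound for one component dominates a bound linear in its size,
      -- and linear bounds add up over the components.
      calc (#W : ℝ) * s ^ (κ - 1) ≤ (#W : ℝ) * (#W : ℝ) ^ (κ - 1) := by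
            refine mul_le_mul_of_nonneg_left ?_ hpos.le
            exact Real.rpow_le_rpow_of_nonpos hpos h2 (by linarith)
        _ = (#W : ℝ) ^ κ := by
            rw [← Real.rpow_one_add' hpos.le (by linarith)]
            congr 1; ring
    · have : ∃ D ⊆ W, D.Nonempty ∧ D ≠ W ∧ ∀ x ∈ D, ∀ y ∈ W, y ∉ D → ¬ H.Adj x y := by
        by_contra hcon
        push Not at hcon
        refine hc ⟨hne, fun D hD h1 h2 => ?_⟩
        exact hcon D hD h1 h2
      obtain ⟨D, hDW, hDne, hDneq, hno⟩ := this
      have hlt : #D < #W := card_lt_card (hDW.ssubset_of_ne hDneq)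
      have hcard : #(W \ D) + #D = #W := card_sdiff_add_card_eq_card hDW
      have i1 := ih #D (hn ▸ hlt) D (fun C hC => hs C (hC.trans hDW))
        (fun C hC => hg C (hC.trans hDW)) rfl
      have i2 := ih #(W \ D) (by have := hDne.card_pos; omega) (W \ D)
        (fun C hC => hs C (hC.trans sdiff_subset)) (fun C hC => hg C (hC.trans sdiff_subset)) rfl
      have h3 : homProd G D + homProd G (W \ D) ≤ homProd G W := by
        rcases hGH with rfl | rfl
        · exact homProd_add_le_of_anticomplete _ hDW sdiff_subset disjoint_sdiff
            (fun x hx y hy => hno x hx y (mem_sdiff.1 hy).1 (mem_sdiff.1 hy).2)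
        · have := homProd_add_le_of_anticomplete Gᶜ hDW sdiff_subset disjoint_sdiff
            (fun x hx y hy => hno x hx y (mem_sdiff.1 hy).1 (mem_sdiff.1 hy).2)
          simpa [homProd_compl] using this
      have h4 : (homProd G D : ℝ) + homProd G (W \ D) ≤ homProd G W := by exact_mod_cast h3
      have h5 : (n : ℝ) = #(W \ D) + #D := by rw [← hn, ← hcard]; push_cast; ring
      rw [h5]
      calc _ = β * #D * s ^ (κ - 1) + β * #(W \ D) * s ^ (κ - 1) := by ring
        _ ≤ _ := by linarith

end Connected

/-! ### Structure forced by excluding an induced $P_5$ -/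

section PathFree

variable {V : Type*}

open Classical in
/-- The neighbours of `v` inside `S`. -/
noncomputable def nbrsOn (H : SimpleGraph V) (S : Finset V) (v : V) : Finset V :=
  S.filter (fun x => H.Adj v x)

@[simp]
theorem mem_nbrsOn {H : SimpleGraph V} {S : Finset V} {v x : V} :
    x ∈ nbrsOn H S v ↔ x ∈ S ∧ H.Adj v x := by
  classical
  simp [nbrsOn]

theorem nbrsOn_subset (H : SimpleGraph V) (S : Finset V) (v : V) : nbrsOn H S v ⊆ S :=
  fun _ hx => (mem_nbrsOn.1 hx).1

theorem nbrsOn_mono (H : SimpleGraph V) {S T : Finset V} (h : S ⊆ T) (v : V) :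
    nbrsOn H S v ⊆ nbrsOn H T v := by
  intro x hx
  simp only [mem_nbrsOn] at hx ⊢
  exact ⟨h hx.1, hx.2⟩

variable {G : SimpleGraph V}

/-- A sparse `P₅`-free graph has a large subset all of whose connected subsets are small. -/
theorem PathFiveFree.not_sparse (hP : PathFiveFree G) {T : Finset V} {η : ℝ} (hη0 : 0 < η)
    (hη : η ≤ 1 / 8) (hT : 4 ≤ η * #T)
    (hc : ∀ W ⊆ T, η ^ 2 / 4 * #T ≤ #W → ∃ C ⊆ W, ConnOn G C ∧ η * #W ≤ #C)
    (hd : ∀ v ∈ T, (#(nbrsOn G T v) : ℝ) ≤ η ^ 4 * #T) : False := by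
  classical
  have ht : (0 : ℝ) < #T := by
    by_contra h
    push Not at h
    nlinarith
  have hη2 : η ^ 2 ≤ η / 8 := by nlinarith
  have hη3 : η ^ 3 ≤ η ^ 2 / 8 := by nlinarith [sq_nonneg η]
  have hη4 : η ^ 4 ≤ η ^ 3 / 8 := by nlinarith [pow_pos hη0 3]
  have hp2 := pow_pos hη0 2
  have hp3 := pow_pos hη0 3
  -- The aim is an induced path `v, a, c, s, t`: peel off the neighbours of `v`, then those of `a`,
  -- passing each time to a component, which is still far larger than any degree.
  obtain ⟨C₀, hC₀T, hC₀, hC₀c⟩ := hc T subset_rfl (by nlinarith)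
  obtain ⟨v, hv⟩ := hC₀.1
  set R := C₀.filter (fun x => x ≠ v ∧ ¬ G.Adj v x) with hR
  have hRC : R ⊆ C₀ := filter_subset _ _
  have hRcard : η / 2 * #T ≤ #R := by
    have h1 : C₀ ⊆ R ∪ (nbrsOn G T v ∪ {v}) := by
      intro x hx
      by_cases h1 : x = v
      · simp [h1]
      by_cases h2 : G.Adj v x
      · simp [h2, hC₀T hx]
      · simp [hR, hx, h1, h2]
    have h2 := (card_le_card h1).trans ((card_union_le _ _).trans
      (Nat.add_le_add_left (card_union_le _ _) _))
    have h3 : (#C₀ : ℝ) ≤ #R + (#(nbrsOn G T v) + 1) := by exact_mod_cast h2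
    have h4 := hd v (hC₀T hv)
    nlinarith
  obtain ⟨C₁, hC₁R, hC₁, hC₁c⟩ := hc R (hRC.trans hC₀T) (by nlinarith)
  obtain ⟨C, hC₁C, hCR, hC, hCmax⟩ := hC₁.exists_component hC₁R
  have hCcard : η ^ 2 / 2 * #T ≤ #C := by
    have : (#C₁ : ℝ) ≤ #C := by exact_mod_cast card_le_card hC₁C
    nlinarith
  have hvR : v ∉ R := by simp [hR]
  obtain ⟨x, hx, a, ha, haC, hxa⟩ := hC₀.2 C (hCR.trans hRC) hC.1 (fun h => hvR (hCR (h ▸ hv)))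
  have hxR := hCR hx
  simp only [hR, mem_filter] at hxR
  have haR : a ∉ R := fun h => haC (mem_of_adj_of_component hCmax hCR hx h hxa)
  have hva : G.Adj v a := by
    by_contra h
    have : a = v := by
      by_contra h'
      exact haR (by simp [hR, ha, h', h])
    exact hxR.2.2 (this ▸ hxa).symm
  set W := C.filter (fun y => ¬ G.Adj a y) with hW
  have hWcard : η ^ 2 / 4 * #T ≤ #W := by
    have h1 : C ⊆ W ∪ nbrsOn G T a := by
      intro y hy
      by_cases h : G.Adj a y
      · simp [h, hC₀T (hRC (hCR hy))]
      · simp [hW, hy, h]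
    have h2 := (card_le_card h1).trans (card_union_le _ _)
    have h3 : (#C : ℝ) ≤ #W + #(nbrsOn G T a) := by exact_mod_cast h2
    have h4 := hd a (hC₀T ha)
    nlinarith
  have hWC : W ⊆ C := filter_subset _ _
  obtain ⟨Q₁, hQ₁W, hQ₁, hQ₁c⟩ := hc W (hWC.trans (hCR.trans (hRC.trans hC₀T))) hWcard
  obtain ⟨Q, hQ₁Q, hQW, hQ, hQmax⟩ := hQ₁.exists_component hQ₁W
  have hxW : x ∉ W := by
    simp only [hW, mem_filter, not_and, not_not]
    exact fun _ => hxa.symm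
  obtain ⟨q, hq, c, hcC, hcQ, hqc⟩ := hC.2 Q (hQW.trans hWC) hQ.1 (fun h => hxW (hQW (h ▸ hx)))
  have hcW : c ∉ W := fun h => hcQ (mem_of_adj_of_component hQmax hQW hq h hqc)
  have hac : G.Adj a c := by
    by_contra h
    exact hcW (by simp [hW, hcC, h])
  have hvn : ∀ y ∈ C, ¬ G.Adj v y := fun y hy => by
    have := hCR hy
    simp only [hR, mem_filter] at this
    exact this.2.2
  have han : ∀ y ∈ W, ¬ G.Adj a y := fun y hy => by
    simp only [hW, mem_filter] at hy
    exact hy.2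
  -- If `c` were mixed on `Q`, an edge `s t` of `Q` would complete the path. So `Q` lies in the
  -- neighbourhood of `c`, yet `#Q ≥ η ^ 3 / 4 * #T` exceeds the degree bound `η ^ 4 * #T`.
  have hcomp : Q ⊆ nbrsOn G T c := by
    intro y hy
    rw [mem_nbrsOn]
    refine ⟨hC₀T (hRC (hCR (hWC (hQW hy)))), ?_⟩
    by_contra hcy
    obtain ⟨s, hs, t, ht, hcs, hct, hst⟩ :=
      hQ.exists_adj_of_mixed (fun z => G.Adj c z) hq hy hqc.symm hcy
    exact hP v a c s t hva hac hcs hst (hvn c hcC) (hvn s (hWC (hQW hs)))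
      (hvn t (hWC (hQW ht))) (han s (hQW hs)) (han t (hQW ht)) hct
  have h1 : (#Q : ℝ) ≤ #(nbrsOn G T c) := by exact_mod_cast card_le_card hcomp
  have h2 := hd c (hC₀T (hRC (hCR hcC)))
  have h3 : (#Q₁ : ℝ) ≤ #Q := by exact_mod_cast card_le_card hQ₁Q
  have h4 : η * (η ^ 2 / 4 * #T) ≤ η * #W := by gcongr
  have h5 : η ^ 4 * #T ≤ η ^ 3 / 8 * #T := by gcongr
  have h6 : 0 < η ^ 3 * #T := by positivity
  nlinarith

/-- The structure of the vertices complete or mixed to a pair `P`, `K`. -/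
theorem PathFiveFree.complete_of_mixed (hP : PathFiveFree G) {v x : V} {P K : Finset V}
    (hPconn : ConnOn G P) (hvP : ∀ p ∈ P, ¬ G.Adj v p) (hvK : ∀ k ∈ K, G.Adj v k)
    (hPK : ∀ k ∈ K, ∀ p ∈ P, ¬ G.Adj k p) (hvx : G.Adj v x)
    {p q : V} (hp : p ∈ P) (hq : q ∈ P) (hxp : G.Adj x p) (hxq : ¬ G.Adj x q) :
    ∀ k ∈ K, G.Adj x k := by
  intro k hk
  by_contra hxk
  obtain ⟨s, hs, t, ht, hxs, hxt, hst⟩ :=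
    hPconn.exists_adj_of_mixed (fun z => G.Adj x z) hp hq hxp hxq
  exact hP k v x s t (hvK k hk).symm hvx hxs hst (fun h => hxk h.symm) (hPK k hk s hs)
    (hPK k hk t ht) (hvP s hs) (hvP t ht) hxt

/-- Co-connectedness of `K` gives nonadjacent `s, t` in `K` with `z` adjacent to `s` only; if `x`
and `z` were nonadjacent, `q, z, s, x, t` would be an induced path. -/
theorem PathFiveFree.adj_of_mixed_of_mixed (hP : PathFiveFree G) {x z : V} {P K : Finset V}
    (hKconn : ConnOn Gᶜ K) (hPK : ∀ k ∈ K, ∀ p ∈ P, ¬ G.Adj k p)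
    {q : V} (hq : q ∈ P) (hxq : ¬ G.Adj x q) (hxK : ∀ k ∈ K, G.Adj x k)
    (hzP : ∀ p ∈ P, G.Adj z p) {k l : V} (hk : k ∈ K) (hl : l ∈ K) (hzk : G.Adj z k)
    (hzl : ¬ G.Adj z l) : G.Adj x z := by
  by_contra hxz
  obtain ⟨s, hs, t, ht, hzs, hzt, hst⟩ :=
    hKconn.exists_adj_of_mixed (fun y => G.Adj z y) hk hl hzk hzl
  exact hP q z s x t (hzP q hq).symm hzs (hxK s hs).symm (hxK t ht)
    (fun h => hPK s hs q hq h.symm) (fun h => hxq h.symm) (fun h => hPK t ht q hq h.symm)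
    (fun h => hxz h.symm) hzt (by rw [SimpleGraph.compl_adj] at hst; exact hst.2)

end PathFree

/-! ### Averaging arguments and the pair `P`, `K` -/

section Counting

variable {V : Type*}

theorem card_nbrsOn_nbrsOn (H K : SimpleGraph V) (S : Finset V) (v a : V) [DecidableRel H.Adj]
    [DecidableRel K.Adj] :
    (#(nbrsOn K (nbrsOn H S v) a) : ℝ) =
      ∑ u ∈ S, if H.Adj v u ∧ K.Adj a u then (1 : ℝ) else 0 := by
  classical
  rw [← Finset.sum_filter, sum_const, nsmul_eq_mul, mul_one]
  congr 2
  ext x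
  simp [and_assoc]

theorem sum_nbrsOn (H : SimpleGraph V) (S : Finset V) (v : V) [DecidableRel H.Adj] (f : V → ℝ) :
    ∑ a ∈ nbrsOn H S v, f a = ∑ a ∈ S, if H.Adj v a then f a else 0 := by
  classical
  rw [← Finset.sum_filter]
  congr 1
  ext x
  simp

/-- Both sides count triples `(v, a, u)` with `a u` an edge of `G` and `v` joined to both in `J`.
With `J = Gᶜ`, edges inside non-neighbourhoods become common non-neighbours of the ends of an edge.
-/
theorem sum_card_nbrsOn_comm (G J : SimpleGraph V) (S : Finset V) :
    ∑ v ∈ S, ∑ a ∈ nbrsOn J S v, (#(nbrsOn G (nbrsOn J S v) a) : ℝ) =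
      ∑ a ∈ S, ∑ u ∈ nbrsOn G S a, (#(nbrsOn J (nbrsOn J S a) u) : ℝ) := by
  classical
  have h1 : ∀ v ∈ S, ∑ a ∈ nbrsOn J S v, (#(nbrsOn G (nbrsOn J S v) a) : ℝ) =
      ∑ a ∈ S, ∑ u ∈ S, if J.Adj v a ∧ J.Adj v u ∧ G.Adj a u then (1 : ℝ) else 0 := by
    intro v _
    rw [sum_nbrsOn]
    refine sum_congr rfl fun a _ => ?_
    by_cases h : J.Adj v a <;> simp [h, card_nbrsOn_nbrsOn]
  have h2 : ∀ a ∈ S, ∑ u ∈ nbrsOn G S a, (#(nbrsOn J (nbrsOn J S a) u) : ℝ) =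
      ∑ v ∈ S, ∑ u ∈ S, if J.Adj v a ∧ J.Adj v u ∧ G.Adj a u then (1 : ℝ) else 0 := by
    intro a _
    rw [sum_nbrsOn, sum_comm]
    refine sum_congr rfl fun u _ => ?_
    by_cases h : G.Adj a u <;> simp only [h, card_nbrsOn_nbrsOn, if_true, if_false, and_true,
      and_false, sum_const_zero]
    refine sum_congr rfl fun v _ => ?_
    simp only [J.adj_comm a v, J.adj_comm u v]
  rw [sum_congr rfl h1, sum_congr rfl h2, sum_comm]

theorem exists_ge_of_sum_ge {S : Finset V} (f : V → ℝ) {c : ℝ} (hS : S.Nonempty)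
    (h : c * #S ≤ ∑ v ∈ S, f v) : ∃ v ∈ S, c ≤ f v := by
  refine Finset.exists_le_of_sum_le hS ?_
  rw [sum_const, nsmul_eq_mul, mul_comm]
  exact h

/-- If few elements have a small value then the sum is large. -/
theorem sum_ge_of_few_small {S : Finset V} (f : V → ℝ) {c : ℝ} (hf : ∀ v ∈ S, 0 ≤ f v)
    (hc : 0 ≤ c) (T : Finset V) (hTS : T ⊆ S) (hT : (#T : ℝ) ≤ #S / 2)
    (h : ∀ v ∈ S, v ∉ T → c ≤ f v) : c * (#S / 2) ≤ ∑ v ∈ S, f v := by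
  classical
  have h1 : (#(S \ T) : ℝ) = #S - #T := by
    rw [card_sdiff_of_subset hTS, Nat.cast_sub (card_le_card hTS)]
  calc c * (#S / 2) ≤ c * #(S \ T) := by
        refine mul_le_mul_of_nonneg_left ?_ hc
        rw [h1]; linarith
    _ = ∑ v ∈ S \ T, c := by rw [sum_const, nsmul_eq_mul, mul_comm]
    _ ≤ ∑ v ∈ S \ T, f v := sum_le_sum fun v hv => h v (mem_sdiff.1 hv).1 (mem_sdiff.1 hv).2
    _ ≤ ∑ v ∈ S, f v := sum_le_sum_of_subset_of_nonneg sdiff_subset fun v hv _ => hf v hv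

/-- If values are at most `m` and the sum is large then many elements have a large value. -/
theorem card_ge_of_sum_ge {S : Finset V} (f : V → ℝ) {m δ : ℝ} (hm : 0 < m)
    (hS : (#S : ℝ) ≤ m) (hδ : 0 ≤ δ) (hf : ∀ v ∈ S, f v ≤ m) (T : Finset V) (hTS : T ⊆ S)
    (hT : ∀ v ∈ S, v ∉ T → f v ≤ δ * m) (h : 2 * δ * m ^ 2 ≤ ∑ v ∈ S, f v) : δ * m ≤ #T := by
  classical
  have h1 : ∑ v ∈ S, f v ≤ δ * m * m + #T * m := by
    rw [← sum_sdiff hTS]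
    refine add_le_add ?_ ?_
    · calc _ ≤ ∑ v ∈ S \ T, δ * m :=
            sum_le_sum fun v hv => hT v (mem_sdiff.1 hv).1 (mem_sdiff.1 hv).2
        _ = #(S \ T) * (δ * m) := by rw [sum_const, nsmul_eq_mul]
        _ ≤ m * (δ * m) := by
            refine mul_le_mul_of_nonneg_right (le_trans ?_ hS) (by positivity)
            exact_mod_cast card_le_card sdiff_subset
        _ = _ := by ring
    · calc _ ≤ ∑ v ∈ T, m := sum_le_sum fun v hv => hf v (hTS hv)
        _ = _ := by rw [sum_const, nsmul_eq_mul]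
  have h2 : (δ * m) * m ≤ #T * m := by nlinarith
  exact le_of_mul_le_mul_right h2 hm

variable {G : SimpleGraph V}

/-- Most non-neighbourhoods `A` have size above `η ^ 3 * #S`. Within `A`, more than `η * #A`
vertices of degree at most `η ^ 5 * #A` would induce a graph sparse enough for `not_sparse`. So `A`
spans many edges, and double counting moves them to pairs `v u`. -/
theorem PathFiveFree.exists_vertex_many_pairs (hP : PathFiveFree G) {S : Finset V} {η : ℝ}
    (hη0 : 0 < η) (hη : η ≤ 1 / 8) (hm : 4 ≤ η ^ 5 * #S)
    (hG : ∀ W ⊆ S, η ^ 26 * #S ≤ #W → ∃ C ⊆ W, ConnOn G C ∧ η * #W ≤ #C)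
    (hlow : ∀ T ⊆ S, (∀ v ∈ T, (#(nbrsOn Gᶜ S v) : ℝ) ≤ η ^ 3 * #S) → (#T : ℝ) ≤ η * #S) :
    ∃ v ∈ S, η ^ 11 / 4 * (#S : ℝ) ^ 2 ≤
      ∑ u ∈ nbrsOn G S v, (#(nbrsOn Gᶜ (nbrsOn Gᶜ S v) u) : ℝ) := by
  classical
  have hS0 : (0 : ℝ) < #S := by
    by_contra h
    push Not at h
    nlinarith [pow_pos hη0 5]
  have hSne : S.Nonempty := by
    rw [← card_pos]; exact_mod_cast hS0
  have key : ∀ v ∈ S, η ^ 3 * #S < #(nbrsOn Gᶜ S v) → η ^ 11 / 2 * (#S : ℝ) ^ 2 ≤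
      ∑ a ∈ nbrsOn Gᶜ S v, (#(nbrsOn G (nbrsOn Gᶜ S v) a) : ℝ) := by
    intro v hv hvd
    set A := nbrsOn Gᶜ S v with hA
    have hAS : A ⊆ S := nbrsOn_subset _ _ _
    have hA0 : (0 : ℝ) < #A := lt_trans (by positivity) hvd
    set T := A.filter (fun a => (#(nbrsOn G A a) : ℝ) ≤ η ^ 5 * #A) with hT
    have hTA : T ⊆ A := filter_subset _ _
    have hTc : (#T : ℝ) ≤ η * #A := by
      by_contra hcon
      push Not at hcon
      have e1 : η * (η ^ 3 * #S) ≤ η * #A := by gcongr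
      refine hP.not_sparse hη0 hη (T := T) ?_ ?_ ?_
      · calc (4 : ℝ) ≤ η * (η * (η ^ 3 * #S)) := by linarith [hm]
          _ ≤ η * #T := by gcongr; linarith
      · intro W hW hWc
        refine hG W (hW.trans (hTA.trans hAS)) (le_trans ?_ hWc)
        calc η ^ 26 * #S ≤ η ^ 7 * #S := by
              gcongr ?_ * _
              exact pow_le_pow_of_le_one hη0.le (by linarith) (by norm_num)
          _ = η ^ 2 * η * (η * (η ^ 3 * #S)) := by ring
          _ ≤ η ^ 2 * (1 / 4) * #T := by
              gcongr
              · linarith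
              · linarith
          _ = _ := by ring
      · intro a ha
        have h1 : (#(nbrsOn G T a) : ℝ) ≤ #(nbrsOn G A a) := by
          exact_mod_cast card_le_card (nbrsOn_mono G hTA a)
        have h2 := (mem_filter.1 ha).2
        calc _ ≤ η ^ 5 * #A := h1.trans h2
          _ = η ^ 4 * (η * #A) := by ring
          _ ≤ _ := by gcongr
    have h1 := sum_ge_of_few_small (S := A) (fun a => (#(nbrsOn G A a) : ℝ)) (c := η ^ 5 * #A)
      (fun _ _ => by positivity) (by positivity) T hTA (by nlinarith) (fun a ha haT => by
        by_contra h
        exact haT (mem_filter.2 ⟨ha, by push Not at h; exact h.le⟩))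
    refine le_trans ?_ h1
    calc η ^ 11 / 2 * (#S : ℝ) ^ 2 = η ^ 5 * (η ^ 3 * #S) * ((η ^ 3 * #S) / 2) := by ring
      _ ≤ _ := by gcongr
  have h2 := sum_ge_of_few_small (S := S)
    (fun v => ∑ a ∈ nbrsOn Gᶜ S v, (#(nbrsOn G (nbrsOn Gᶜ S v) a) : ℝ))
    (c := η ^ 11 / 2 * (#S : ℝ) ^ 2) (fun _ _ => by positivity) (by positivity)
    (S.filter (fun v => (#(nbrsOn Gᶜ S v) : ℝ) ≤ η ^ 3 * #S)) (filter_subset _ _)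
    ((hlow _ (filter_subset _ _) (fun v hv => (mem_filter.1 hv).2)).trans (by nlinarith))
    (fun v hv hvT => key v hv (by
      by_contra h
      exact hvT (mem_filter.2 ⟨hv, not_lt.1 h⟩)))
  rw [sum_card_nbrsOn_comm] at h2
  refine exists_ge_of_sum_ge _ hSne (le_trans (le_of_eq ?_) h2)
  ring

/-- A `P₅`-free graph with no large sets having only small components, and with few vertices of
small co-degree, contains a large connected set `P` and a large co-connected set `K` with no edges
between them, and a vertex complete to `K` and anticomplete to `P`. -/
theorem PathFiveFree.exists_pair (hP : PathFiveFree G) {S : Finset V} {η : ℝ}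
    (hη0 : 0 < η) (hη : η ≤ 1 / 8) (hm : 1 ≤ η ^ 26 * #S)
    (hG : ∀ W ⊆ S, η ^ 26 * #S ≤ #W → ∃ C ⊆ W, ConnOn G C ∧ η * #W ≤ #C)
    (hJ : ∀ W ⊆ S, η ^ 26 * #S ≤ #W → ∃ C ⊆ W, ConnOn Gᶜ C ∧ η * #W ≤ #C)
    (hlow : ∀ T ⊆ S, (∀ v ∈ T, (#(nbrsOn Gᶜ S v) : ℝ) ≤ η ^ 3 * #S) → (#T : ℝ) ≤ η * #S) :
    ∃ v ∈ S, ∃ P K : Finset V, P ⊆ nbrsOn Gᶜ S v ∧ K ⊆ nbrsOn G S v ∧ ConnOn G P ∧ ConnOn Gᶜ K ∧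
      (∀ k ∈ K, ∀ p ∈ P, ¬ G.Adj k p) ∧ η ^ 26 * #S ≤ #P ∧ η ^ 26 * #S ≤ #K := by
  classical
  have hη1 : η ≤ 1 := by linarith
  have hpow : ∀ {i j : ℕ}, i ≤ j → η ^ j ≤ η ^ i := fun h => pow_le_pow_of_le_one hη0.le hη1 h
  have hS0 : (0 : ℝ) < #S := by
    by_contra h
    push Not at h
    nlinarith [pow_pos hη0 26]
  have hm5 : 4 ≤ η ^ 5 * #S := by
    have h1 : η ^ 26 * #S ≤ η ^ 6 * #S := by gcongr ?_ * _; exact hpow (by norm_num)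
    have h2 : η ^ 6 * #S = η * (η ^ 5 * #S) := by ring
    have h3 : 0 < η ^ 5 * #S := by positivity
    nlinarith
  obtain ⟨v, hv, hsum⟩ := hP.exists_vertex_many_pairs hη0 hη hm5 hG hlow
  set A := nbrsOn Gᶜ S v with hA
  set U := nbrsOn G S v with hU
  have hAS : A ⊆ S := nbrsOn_subset _ _ _
  have hUS : U ⊆ S := nbrsOn_subset _ _ _
  set U' := U.filter (fun u => η ^ 12 * #S ≤ #(nbrsOn Gᶜ A u)) with hU'
  have hU'U : U' ⊆ U := filter_subset _ _
  have h8 : η ^ 12 ≤ η ^ 11 / 8 := by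
    have : η ^ 12 = η ^ 11 * η := by ring
    rw [this]
    have := pow_pos hη0 11
    nlinarith
  have hU'card : η ^ 12 * #S ≤ #U' := by
    refine card_ge_of_sum_ge (S := U) (fun u => (#(nbrsOn Gᶜ A u) : ℝ)) hS0
      (by exact_mod_cast card_le_card hUS) (by positivity)
      (fun u _ => by exact_mod_cast card_le_card ((nbrsOn_subset _ _ _).trans hAS)) U' hU'U
      (fun u hu hu' => ?_) (le_trans ?_ hsum)
    · by_contra h
      exact hu' (mem_filter.2 ⟨hu, (not_le.1 h).le⟩)
    · gcongr
      linarith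
  -- `P u` is a large component of the common non-neighbourhood of `v` and `u`; outside `U'` its
  -- value is irrelevant.
  have hcomp : ∀ u, ∃ P : Finset V, u ∈ U' → P ⊆ nbrsOn Gᶜ A u ∧ ConnOn G P ∧
      (∀ D ⊆ nbrsOn Gᶜ A u, ConnOn G D → ∀ x ∈ D, x ∈ P → D ⊆ P) ∧ η ^ 13 * #S ≤ #P := by
    intro u
    by_cases hu : u ∈ U'
    · have h1 := (mem_filter.1 hu).2
      obtain ⟨C, hC, hCc, hCcard⟩ := hG (nbrsOn Gᶜ A u) ((nbrsOn_subset _ _ _).trans hAS)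
        (le_trans (by gcongr ?_ * _; exact hpow (by norm_num)) h1)
      obtain ⟨P, hCP, hPW, hPc, hPmax⟩ := hCc.exists_component hC
      refine ⟨P, fun _ => ⟨hPW, hPc, hPmax, ?_⟩⟩
      have h2 : (#C : ℝ) ≤ #P := by exact_mod_cast card_le_card hCP
      calc η ^ 13 * #S = η * (η ^ 12 * #S) := by ring
        _ ≤ η * #(nbrsOn Gᶜ A u) := by gcongr
        _ ≤ _ := hCcard.trans h2
    · exact ⟨∅, fun h => absurd h hu⟩
  choose P hPs using hcomp
  -- Averaging finds a vertex `w` in many of the sets `P u`; sharing `w` is what lets two of these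
  -- components be identified.
  have hex : ∃ w ∈ S, η ^ 25 * #S ≤ ∑ u ∈ U', if w ∈ P u then (1 : ℝ) else 0 := by
    refine exists_ge_of_sum_ge _ (card_pos.1 (by exact_mod_cast hS0)) ?_
    rw [sum_comm]
    calc η ^ 25 * #S * #S = (η ^ 12 * #S) * (η ^ 13 * #S) := by ring
      _ ≤ #U' * (η ^ 13 * #S) := by gcongr
      _ = ∑ u ∈ U', η ^ 13 * #S := by rw [sum_const, nsmul_eq_mul]
      _ ≤ _ := sum_le_sum fun u hu => ?_
    rw [← sum_filter, sum_const, nsmul_eq_mul, mul_one]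
    refine (hPs u hu).2.2.2.trans ?_
    have : P u ⊆ S.filter (fun x => x ∈ P u) := fun x hx => mem_filter.2
      ⟨hAS (nbrsOn_subset _ _ _ ((hPs u hu).1 hx)), hx⟩
    exact_mod_cast card_le_card this
  obtain ⟨w, hw, hwsum⟩ := hex
  rw [← sum_filter, sum_const, nsmul_eq_mul, mul_one] at hwsum
  set Uw := U'.filter (fun u => w ∈ P u) with hUw
  have hUwU' : Uw ⊆ U' := filter_subset _ _
  obtain ⟨K, hKU, hK, hKcard⟩ := hJ Uw (hUwU'.trans (hU'U.trans hUS))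
    (le_trans (by gcongr ?_ * _; exact hpow (by norm_num)) hwsum)
  -- For nonadjacent `x, y`, a neighbour of `y` in `P x` would make `y` mixed on `P x` (it misses
  -- `w`), hence adjacent to `x`. So `P x` avoids the neighbours of `y` and lies in the component `P
  -- y`.
  have hstep : ∀ x ∈ Uw, ∀ y ∈ Uw, Gᶜ.Adj x y → P x ⊆ P y := by
    intro x hx y hy hxy
    have hxU' := hUwU' hx
    have hyU' := hUwU' hy
    have hwx := (mem_filter.1 hx).2
    have hwy := (mem_filter.1 hy).2
    obtain ⟨hx1, hx2, -, -⟩ := hPs x hxU'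
    obtain ⟨hy1, hy2, hy3, -⟩ := hPs y hyU'
    refine hy3 (P x) ?_ hx2 w hwx hwy
    intro t ht
    have htx := hx1 ht
    rw [mem_nbrsOn] at htx ⊢
    refine ⟨htx.1, ?_⟩
    have hvx : G.Adj v x := (mem_nbrsOn.1 (hU'U hxU')).2
    have hvy : G.Adj v y := (mem_nbrsOn.1 (hU'U hyU')).2
    have hvA : ∀ z ∈ P x, ¬ G.Adj v z := fun z hz => by
      have := mem_nbrsOn.1 (mem_nbrsOn.1 (hx1 hz)).1
      exact ((SimpleGraph.compl_adj ..).1 this.2).2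
    have hxA : ∀ z ∈ P x, ¬ G.Adj x z := fun z hz => by
      exact ((SimpleGraph.compl_adj ..).1 (mem_nbrsOn.1 (hx1 hz)).2).2
    have hyw : ¬ G.Adj y w := ((SimpleGraph.compl_adj ..).1 (mem_nbrsOn.1 (hy1 hwy)).2).2
    rw [SimpleGraph.compl_adj] at hxy ⊢
    refine ⟨fun h => hvA t ht (h ▸ hvy), fun hyt => ?_⟩
    have := hP.complete_of_mixed (K := {x}) hx2 hvA (by simpa using hvx)
      (by simpa using hxA) hvy ht hwx hyt hyw x (by simp)
    exact hxy.2 this.symm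
  obtain ⟨u₀, hu₀⟩ := hK.1
  -- Nonadjacent vertices share their component, so `P` is constant on the co-connected set `K`.
  have hconst : ∀ u ∈ K, P u = P u₀ := by
    intro u hu
    by_contra hne
    obtain ⟨x, hx, y, hy, hpx, hpy, hxy⟩ :=
      hK.exists_adj_of_mixed (fun z => P z = P u₀) hu₀ hu rfl hne
    refine hpy ?_
    rw [← hpx]
    exact (hstep y (hKU hy) x (hKU hx) hxy.symm).antisymm (hstep x (hKU hx) y (hKU hy) hxy)
  have hu₀' := hUwU' (hKU hu₀)
  obtain ⟨hp1, hp2, -, hp4⟩ := hPs u₀ hu₀'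
  refine ⟨v, hv, P u₀, K, hp1.trans (nbrsOn_subset _ _ _), hKU.trans (hUwU'.trans hU'U), hp2, hK,
    ?_, le_trans ?_ hp4, le_trans ?_ hKcard⟩
  · intro k hk p hp
    have : p ∈ nbrsOn Gᶜ A k := (hPs k (hUwU' (hKU hk))).1 (hconst k hk ▸ hp)
    exact ((SimpleGraph.compl_adj ..).1 (mem_nbrsOn.1 this).2).2
  · gcongr ?_ * _; exact hpow (by norm_num)
  · calc η ^ 26 * #S = η * (η ^ 25 * #S) := by ring
      _ ≤ _ := by gcongr

end Counting

/-! ### The induction on the size of the set -/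

section Recursion

variable {V : Type*}

/-- A graph with small co-degrees has a large clique. -/
theorem exists_clique_of_codegree_le (G : SimpleGraph V) (S : Finset V) {d : ℝ}
    (hd : ∀ v ∈ S, (#(nbrsOn Gᶜ S v) : ℝ) ≤ d) :
    ∃ T ⊆ S, G.IsClique (T : Set V) ∧ (#S : ℝ) ≤ #T * (d + 1) := by
  classical
  obtain ⟨T, hTS, hT, hcard⟩ := exists_cliqueNumOn_eq G S
  refine ⟨T, hTS, hT, ?_⟩
  -- `T` is a maximum clique, so every vertex of `S` outside it has a non-neighbour in `T`.
  have hcov : S ⊆ T.biUnion (fun t => insert t (nbrsOn Gᶜ S t)) := by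
    intro x hx
    by_contra hcon
    simp only [mem_biUnion, mem_insert, mem_nbrsOn, not_exists, not_and, not_or] at hcon
    have hxT : x ∉ T := fun h => (hcon x h).1 rfl
    have hcl : G.IsClique ((insert x T : Finset V) : Set V) := by
      rw [coe_insert, SimpleGraph.isClique_insert]
      refine ⟨hT, fun t ht hxt => ?_⟩
      have := (hcon t ht).2 hx
      rw [SimpleGraph.compl_adj] at this
      by_contra h
      exact this ⟨fun h' => hxt h'.symm, fun h' => h h'.symm⟩
    have h1 := le_cliqueNumOn (insert_subset hx hTS) hcl
    rw [card_insert_of_notMem hxT, ← hcard] at h1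
    omega
  have h1 := (card_le_card hcov).trans card_biUnion_le
  have h2 : (#S : ℝ) ≤ ∑ t ∈ T, (#(insert t (nbrsOn Gᶜ S t)) : ℝ) := by exact_mod_cast h1
  refine h2.trans ?_
  calc _ ≤ ∑ t ∈ T, (d + 1) := sum_le_sum fun t ht => by
        have h3 : (#(insert t (nbrsOn Gᶜ S t)) : ℝ) ≤ #(nbrsOn Gᶜ S t) + 1 := by
          exact_mod_cast card_insert_le _ _
        linarith [hd t (hTS ht)]
    _ = _ := by rw [sum_const, nsmul_eq_mul]

/-- Small components gain a factor `e ^ (1 - κ)`. This pays for `e ^ (28 * κ)`, with 26 from the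
size of the set and 2 from the sparsity term, because `29 * κ ≤ 1`. -/
theorem rpow_le_of_small_components {m w e κ : ℝ} (hm : 0 < m) (he : 1 ≤ e) (hκ0 : 0 < κ)
    (hκ : κ ≤ 1 / 100) (hw : (1 / e) ^ 26 * m ≤ w) :
    (m * e ^ 2) ^ κ ≤ w * (1 / e * w) ^ (κ - 1) := by
  have he0 : 0 < e := by linarith
  have hw0 : 0 < w := lt_of_lt_of_le (by positivity) hw
  have h1 : w * (1 / e * w) ^ (κ - 1) = w ^ κ * e ^ (1 - κ) := by
    rw [Real.mul_rpow (by positivity) hw0.le, one_div, Real.inv_rpow he0.le, ← Real.rpow_neg he0.le,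
      neg_sub, Real.rpow_sub_one hw0.ne']
    field_simp
  rw [h1]
  have h2 : m ≤ e ^ 26 * w := by
    calc m = e ^ 26 * ((1 / e) ^ 26 * m) := by field_simp
      _ ≤ _ := by gcongr
  calc (m * e ^ 2) ^ κ ≤ (w * e ^ 28) ^ κ := by
        refine Real.rpow_le_rpow (by positivity) ?_ hκ0.le
        calc m * e ^ 2 ≤ (e ^ 26 * w) * e ^ 2 := by gcongr
          _ = _ := by ring
    _ = w ^ κ * e ^ (28 * κ) := by
        rw [Real.mul_rpow hw0.le (by positivity), ← Real.rpow_natCast_mul he0.le]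
        norm_num
    _ ≤ _ := by
        gcongr
        linarith

variable {G : SimpleGraph V}

set_option maxHeartbeats 1600000 in
/-- The growth rate of `homProd` in `P₅`-free graphs without large cliques: a bound that improves
with the sparsity `y` of the complement. -/
theorem PathFiveFree.rpow_le_homProd (hP : PathFiveFree G) {z Y κ : ℝ} (hz : 8 ≤ z)
    (hzY : z ^ 3 ≤ Y) (hκ0 : 0 < κ) (hκ : κ ≤ 1 / 100) (hzκ : z ^ (87 * κ) ≤ 2)
    (hYκ : 2 * Y ^ (28 * κ) ≤ z) (hcl : ∀ T : Finset V, G.IsClique (T : Set V) → (#T : ℝ) < Y / 2)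
    (S : Finset V) (hS : S.Nonempty) (y : ℝ) (hy1 : 1 ≤ y) (hyY : y ≤ Y ^ 2)
    (hyS : ∀ v ∈ S, y * #(nbrsOn Gᶜ S v) ≤ #S) :
    (#S * y ^ 2 / Y ^ 34) ^ κ ≤ homProd G S := by
  classical
  induction hn : #S using Nat.strong_induction_on generalizing S y with
  | _ n ih =>
  subst hn
  have hz512 : (512 : ℝ) ≤ z ^ 3 := by
    calc (512 : ℝ) = 8 ^ 3 := by norm_num
      _ ≤ _ := by gcongr
  have hz64 : z * 64 ≤ z ^ 3 := by
    have h64 : (8 : ℝ) ^ 2 ≤ z ^ 2 := by gcongr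
    calc z * 64 ≤ z * z ^ 2 := by gcongr; linarith
      _ = z ^ 3 := by ring
  have hY1 : 1 ≤ Y := by linarith
  have hY0 : 0 < Y := by linarith
  -- The exponent 34 is 30 + 4: for `#S ≤ Y ^ 30`, the bound `y ≤ Y ^ 2` makes the claim at most 1.
  have hm0 : (0 : ℝ) < #S := by exact_mod_cast hS.card_pos
  by_cases hbase : (#S : ℝ) ≤ Y ^ 30
  · refine le_trans (Real.rpow_le_one (by positivity) ?_ hκ0.le)
      (by exact_mod_cast one_le_homProd G hS)
    rw [div_le_one (by positivity)]
    calc (#S : ℝ) * y ^ 2 ≤ Y ^ 30 * (Y ^ 2) ^ 2 := by gcongr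
      _ = _ := by ring
  push Not at hbase
  have hYm : Y ≤ #S := le_trans (by simpa using pow_le_pow_right₀ hY1 (show 1 ≤ 30 by norm_num))
    hbase.le
  by_cases hyY' : Y ≤ y
  · exfalso
    obtain ⟨T, -, hT, hTc⟩ := exists_clique_of_codegree_le G S (d := #S / Y) (fun v hv => by
      rw [le_div_iff₀ hY0]
      calc _ ≤ (#(nbrsOn Gᶜ S v) : ℝ) * y := by gcongr
        _ ≤ _ := by linarith [hyS v hv])
    have h1 := hcl T hT
    have h2 : (#T : ℝ) * (#S / Y + 1) < Y / 2 * (#S / Y + 1) := by gcongr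
    have h3 : Y / 2 * (#S / Y + 1) = #S / 2 + Y / 2 := by field_simp
    linarith
  push Not at hyY'
  by_contra hlt
  push Not at hlt
  -- Raising `y` to `e` only weakens the upper bound on `homProd G S`, and makes `η = 1 / e` small
  -- enough for the structural lemmas.
  obtain ⟨e, he⟩ : ∃ e, e = max y (z ^ 3) := ⟨_, rfl⟩
  have hye : y ≤ e := he ▸ le_max_left _ _
  have hze : z ^ 3 ≤ e := he ▸ le_max_right _ _
  have heY : e ≤ Y := he ▸ max_le hyY'.le hzY
  have he1 : 1 ≤ e := by linarith
  have he0 : 0 < e := by linarith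
  obtain ⟨η, hη⟩ : ∃ η, η = 1 / e := ⟨_, rfl⟩
  have hη0 : 0 < η := hη ▸ by positivity
  have hηe : η * e = 1 := by rw [hη]; field_simp
  have hη512 : η ≤ 1 / 512 := by
    rw [hη]; gcongr; linarith
  have hη8 : η ≤ 1 / 8 := by linarith
  have hlt' : (homProd G S : ℝ) < (#S * e ^ 2 / Y ^ 34) ^ κ := by
    refine lt_of_lt_of_le hlt (Real.rpow_le_rpow (by positivity) ?_ hκ0.le)
    gcongr
  have hηm : ∀ i : ℕ, i ≤ 29 → 512 ≤ η ^ i * #S := by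
    intro i hi
    have h1 : e ^ 30 ≤ #S := le_trans (by gcongr) hbase.le
    calc (512 : ℝ) ≤ e := by linarith
      _ ≤ e ^ (30 - i) := by
        simpa using pow_le_pow_right₀ he1 (show 1 ≤ 30 - i by omega)
      _ = η ^ i * (e ^ i * e ^ (30 - i)) := by
        rw [← mul_assoc, ← mul_pow, hηe]; simp
      _ = η ^ i * e ^ 30 := by rw [← pow_add]; congr 2; omega
      _ ≤ _ := by gcongr
  have ih1 : ∀ C ⊆ S, C.Nonempty → #C < #S → (#C / Y ^ 34 : ℝ) ^ κ ≤ homProd G C := by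
    intro C hC hne hcard
    have := ih #C hcard C hne 1 le_rfl (one_le_pow₀ hY1) (fun v hv => by
      rw [one_mul]; exact_mod_cast card_le_card (nbrsOn_subset _ _ _)) rfl
    simpa using this
  have hconn : ∀ H : SimpleGraph V, (H = G ∨ H = Gᶜ) → ∀ W ⊆ S, η ^ 26 * #S ≤ #W →
      ∃ C ⊆ W, ConnOn H C ∧ η * #W ≤ #C := by
    intro H hH W hW hWc
    by_contra hcon
    push Not at hcon
    have hW0 : (0 : ℝ) < #W := lt_of_lt_of_le (by positivity) hWc
    have hWS : (#W : ℝ) ≤ #S := by exact_mod_cast card_le_card hW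
    have h1 := homProd_ge_of_small_components G H hH (β := (1 / Y ^ 34) ^ κ) (s := η * #W)
      (by positivity) hκ0 (by linarith) W (fun C hC hCc => (hcon C hC hCc).le)
      (fun C hC hCc => by
        rw [← Real.mul_rpow (by positivity) (by positivity), one_div_mul_eq_div]
        refine ih1 C (hC.trans hW) hCc.1 ?_
        have := hcon C hC hCc
        have h2 : (#C : ℝ) < #S :=
          this.trans_le ((mul_le_of_le_one_left hW0.le (by linarith)).trans hWS)
        exact_mod_cast h2)
    have h2 : (homProd G W : ℝ) ≤ homProd G S := by exact_mod_cast homProd_mono G hW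
    have h3 := rpow_le_of_small_components (κ := κ) hm0 he1 hκ0 hκ (w := #W) (hη ▸ hWc)
    rw [← hη] at h3
    have h4 : (#S * e ^ 2 / Y ^ 34) ^ κ = (1 / Y ^ 34) ^ κ * (#S * e ^ 2) ^ κ := by
      rw [← Real.mul_rpow (by positivity) (by positivity), one_div_mul_eq_div]
    have h5 : (1 / Y ^ 34) ^ κ * (#S * e ^ 2) ^ κ ≤
        (1 / Y ^ 34) ^ κ * (#W * (η * #W) ^ (κ - 1)) := by gcongr
    rw [h4] at hlt'
    linarith
  -- A large set of vertices of very small co-degree has sparsity about `e ^ 2`, and the gain in the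
  -- sparsity term outweighs the loss of size. This squaring is why `y` must range up to `Y ^ 2`
  -- although `e ≤ Y`. One vertex is erased so that the set is strictly smaller than `S`.
  have hlow : ∀ T ⊆ S, (∀ v ∈ T, (#(nbrsOn Gᶜ S v) : ℝ) ≤ η ^ 3 * #S) → (#T : ℝ) ≤ η * #S := by
    intro T hT hTd
    by_contra hcon
    push Not at hcon
    have h512 := hηm 1 (by norm_num)
    rw [pow_one] at h512
    have hTne : T.Nonempty := by
      rw [← card_pos]
      have : (0 : ℝ) < #T := by linarith
      exact_mod_cast this
    obtain ⟨x, hx⟩ := hTne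
    have hcard : (#(T.erase x) : ℝ) + 1 = #T := by exact_mod_cast card_erase_add_one hx
    have hlt2 : #(T.erase x) < #S :=
      lt_of_lt_of_le (card_erase_lt_of_mem hx) (card_le_card hT)
    have h1 := ih _ hlt2 (T.erase x) (by
        rw [← card_pos]
        have : (0 : ℝ) < #(T.erase x) := by linarith
        exact_mod_cast this) (e ^ 2 / 2)
      (by have := pow_le_pow_left₀ (by norm_num) (show (2 : ℝ) ≤ e by linarith) 2; linarith)
      (by have := pow_le_pow_left₀ he0.le heY 2; linarith [sq_nonneg e]) (fun v hv => by
        have h2 : (#(nbrsOn Gᶜ (T.erase x) v) : ℝ) ≤ #(nbrsOn Gᶜ S v) := by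
          exact_mod_cast card_le_card (nbrsOn_mono Gᶜ ((erase_subset _ _).trans hT) v)
        have h3 := h2.trans (hTd v (mem_of_mem_erase hv))
        calc e ^ 2 / 2 * (#(nbrsOn Gᶜ (T.erase x) v) : ℝ) ≤ e ^ 2 / 2 * (η ^ 3 * #S) := by gcongr
          _ = (η * e) ^ 2 * (η * #S / 2) := by ring
          _ ≤ _ := by rw [hηe]; linarith) rfl
    have h2 : (homProd G (T.erase x) : ℝ) ≤ homProd G S := by
      exact_mod_cast homProd_mono G ((erase_subset _ _).trans hT)
    have h3 : (#S * e ^ 2 / Y ^ 34) ^ κ ≤ (#(T.erase x) * (e ^ 2 / 2) ^ 2 / Y ^ 34) ^ κ := by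
      refine Real.rpow_le_rpow (by positivity) ?_ hκ0.le
      gcongr ?_ / _
      calc (#S : ℝ) * e ^ 2 = (η * e) * #S * e ^ 2 := by rw [hηe, one_mul]
        _ = η * #S / 2 * (e ^ 2 * 2 * e) := by ring
        _ ≤ #(T.erase x) * (e ^ 2 * (e / 4) * e) := by
            gcongr
            · linarith
            · linarith
        _ = _ := by ring
    linarith
  obtain ⟨v, hv, P, K, hPA, hKU, hPc, hKc, hPK, hPcard, hKcard⟩ := hP.exists_pair hη0 hη8
    (by linarith [hηm 26 (by norm_num)]) (hconn G (Or.inl rfl)) (hconn Gᶜ (Or.inr rfl)) hlow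
  have hvP : ∀ p ∈ P, ¬ G.Adj v p := fun p hp =>
    ((SimpleGraph.compl_adj ..).1 (mem_nbrsOn.1 (hPA hp)).2).2
  have hvK : ∀ k ∈ K, G.Adj v k := fun k hk => (mem_nbrsOn.1 (hKU hk)).2
  have hPS : P ⊆ S := hPA.trans (nbrsOn_subset _ _ _)
  have hKS : K ⊆ S := hKU.trans (nbrsOn_subset _ _ _)
  obtain ⟨p₀, hp₀⟩ := hPc.1
  obtain ⟨k₀, hk₀⟩ := hKc.1
  set U := nbrsOn G S v with hU
  have hUS : U ⊆ S := nbrsOn_subset _ _ _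
  set X := U.filter (fun x => (∃ p ∈ P, G.Adj x p) ∧ ∃ q ∈ P, ¬ G.Adj x q) with hX
  set Z := U.filter (fun x => ∀ p ∈ P, G.Adj x p) with hZ
  set CP := U.filter (fun x => ∀ p ∈ P, ¬ G.Adj x p) with hCP
  have hXS : X ⊆ S := (filter_subset _ _).trans hUS
  have hZS : Z ⊆ S := (filter_subset _ _).trans hUS
  have hCPS : CP ⊆ S := (filter_subset _ _).trans hUS
  have hXK : ∀ x ∈ X, ∀ k ∈ K, G.Adj x k := by
    intro x hx
    obtain ⟨hxU, ⟨p, hp, hxp⟩, q, hq, hxq⟩ := mem_filter.1 hx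
    exact hP.complete_of_mixed hPc hvP hvK hPK (mem_nbrsOn.1 hxU).2 hp hq hxp hxq
  have hUcov : U ⊆ X ∪ (Z ∪ CP) := by
    intro x hx
    by_cases h1 : ∃ p ∈ P, G.Adj x p
    · by_cases h2 : ∃ q ∈ P, ¬ G.Adj x q
      · exact mem_union_left _ (mem_filter.2 ⟨hx, h1, h2⟩)
      · push Not at h2
        exact mem_union_right _ (mem_union_left _ (mem_filter.2 ⟨hx, h2⟩))
    · push Not at h1
      exact mem_union_right _ (mem_union_right _ (mem_filter.2 ⟨hx, h1⟩))
  have hUc : (#U : ℝ) ≤ #X + (#Z + #CP) := by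
    exact_mod_cast (card_le_card hUcov).trans ((card_union_le _ _).trans
      (Nat.add_le_add_left (card_union_le _ _) _))
  have hdisj : ∀ A B : Finset V, (∀ x ∈ A, ∀ y ∈ B, G.Adj x y) → Disjoint A B := by
    intro A B h
    rw [Finset.disjoint_left]
    exact fun x hx hx' => G.loopless.irrefl x (h x hx x hx')
  have hproper : ∀ A B : Finset V, A ⊆ S → B ⊆ S → B.Nonempty → Disjoint A B → #A < #S := by
    intro A B hA hB hBne hd
    refine card_lt_card (hA.ssubset_of_ne ?_)
    rintro rfl
    obtain ⟨b, hb⟩ := hBne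
    exact Finset.disjoint_left.1 hd (hB hb) hb
  have hne : ∀ A : Finset V, ∀ c : ℝ, 0 < c → c ≤ #A → A.Nonempty := by
    intro A c hc h
    rw [← card_pos]
    have : (0 : ℝ) < #A := by linarith
    exact_mod_cast this
  by_cases hyz : y < z ^ 3
  · have hez : e = z ^ 3 := he.trans (max_eq_right hyz.le)
    -- Passing to either set costs `e ^ 29 = z ^ 87` inside the power (27 for size, 2 for sparsity),
    -- hence a factor at most 2.
    have hpair : ∀ A B : Finset V, A ⊆ S → B ⊆ S → η ^ 27 * #S ≤ #A → η ^ 27 * #S ≤ #B →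
        Disjoint A B → homProd G A + homProd G B ≤ homProd G S → False := by
      intro A B hA hB hAc hBc hd hsum
      have hAne := hne A _ (by positivity) hAc
      have hBne := hne B _ (by positivity) hBc
      have h1 := ih1 A hA hAne (hproper A B hA hB hBne hd)
      have h2 := ih1 B hB hBne (hproper B A hB hA hAne hd.symm)
      have h3 : (homProd G A : ℝ) + homProd G B ≤ homProd G S := by exact_mod_cast hsum
      have h4 : ∀ C : Finset V, η ^ 27 * #S ≤ #C →
          (#S * e ^ 2 / Y ^ 34) ^ κ ≤ 2 * (#C / Y ^ 34 : ℝ) ^ κ := by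
        intro C hC
        calc (#S * e ^ 2 / Y ^ 34) ^ κ = (e ^ 29 * (η ^ 27 * #S / Y ^ 34)) ^ κ := by
              congr 1
              have : e ^ 29 * η ^ 27 = e ^ 2 := by
                calc e ^ 29 * η ^ 27 = (η * e) ^ 27 * e ^ 2 := by ring
                  _ = _ := by rw [hηe]; ring
              calc _ = e ^ 2 * #S / Y ^ 34 := by ring
                _ = _ := by rw [← this]; ring
          _ ≤ (e ^ 29 * (#C / Y ^ 34)) ^ κ := by gcongr
          _ = z ^ (87 * κ) * (#C / Y ^ 34 : ℝ) ^ κ := by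
              rw [Real.mul_rpow (by positivity) (by positivity), hez, ← pow_mul,
                ← Real.rpow_natCast_mul (by linarith)]
              norm_num
          _ ≤ _ := by gcongr
      have h5 := h4 A hAc
      have h6 := h4 B hBc
      linarith
    have hKU' : (#K : ℝ) ≤ #U := by exact_mod_cast card_le_card hKU
    have h27 : η ^ 27 * #S ≤ η ^ 26 * #S / 3 := by
      have : η ^ 27 * #S = η * (η ^ 26 * #S) := by ring
      have h0 : 0 < η ^ 26 * #S := by positivity
      have h1 := mul_le_mul_of_nonneg_right hη8 h0.le
      linarith
    have h0 : 0 < η ^ 26 * #S := by positivity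
    by_cases hXc : η ^ 27 * #S ≤ #X
    · exact hpair X K hXS hKS hXc (by linarith) (hdisj _ _ hXK)
        (homProd_add_le_of_complete G hXS hKS hXK)
    by_cases hZc : η ^ 27 * #S ≤ #Z
    · have hZP : ∀ x ∈ Z, ∀ p ∈ P, G.Adj x p := fun x hx => (mem_filter.1 hx).2
      exact hpair Z P hZS hPS hZc (by linarith) (hdisj _ _ hZP)
        (homProd_add_le_of_complete G hZS hPS hZP)
    have hd : Disjoint CP P := by
      rw [Finset.disjoint_left]
      intro x hx hx'
      exact hvP x hx' (mem_nbrsOn.1 (mem_filter.1 hx).1).2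
    exact hpair CP P hCPS hPS (by linarith) (by linarith) hd
      (homProd_add_le_of_anticomplete G hCPS hPS hd (fun x hx => (mem_filter.1 hx).2))
  push Not at hyz
  have hey : e = y := he.trans (max_eq_left hyz)
  rw [← hey] at hyS hlt
  have hdeg : ∀ x ∈ S, (#(nbrsOn Gᶜ S x) : ℝ) ≤ η * #S := by
    intro x hx
    rw [hη, one_div_mul_eq_div, le_div_iff₀ he0, mul_comm]
    exact hyS x hx
  obtain ⟨ρ, hρ⟩ : ∃ ρ, ρ = 1 / z := ⟨_, rfl⟩
  have hz0 : 0 < z := by linarith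
  have hρ0 : 0 < ρ := hρ ▸ by positivity
  have hρz : ρ * z = 1 := by rw [hρ]; field_simp
  have hρ8 : ρ ≤ 1 / 8 := by rw [hρ]; gcongr
  have hηρ : η ≤ ρ / 64 := by
    rw [hη, hρ, div_div]
    gcongr
    exact hz64.trans hze
  have hsmall : 3 * (η * #S) + 3 ≤ ρ * #S := by
    have h1 := hηm 1 (by norm_num)
    rw [pow_one] at h1
    have h2 : η * #S ≤ ρ / 64 * #S := by gcongr
    linarith
  -- A subset of proportion `τ` keeps sparsity `τ * e`, so the quantity size times sparsity squared
  -- loses only `τ ^ 3`.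
  have hIHS : ∀ (A : Finset V) (τ : ℝ), A ⊆ S → A.Nonempty → #A < #S → 0 < τ → τ ≤ 1 →
      1 ≤ τ * e → τ * #S ≤ #A →
      (τ ^ 3) ^ κ * (#S * e ^ 2 / Y ^ 34) ^ κ ≤ homProd G A := by
    intro A τ hA hAne hAlt hτ0 hτ1 hτe hτA
    have := ih #A hAlt A hAne (τ * e) hτe
      ((mul_le_of_le_one_left he0.le hτ1).trans (heY.trans (le_self_pow₀ hY1 two_ne_zero))) (fun x hx => by
      have h1 : (#(nbrsOn Gᶜ A x) : ℝ) ≤ #(nbrsOn Gᶜ S x) := by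
        exact_mod_cast card_le_card (nbrsOn_mono Gᶜ hA x)
      calc τ * e * #(nbrsOn Gᶜ A x) ≤ τ * (e * #(nbrsOn Gᶜ S x)) := by
            rw [mul_assoc]; gcongr
        _ ≤ τ * #S := by gcongr; exact hyS x (hA hx)
        _ ≤ _ := hτA) rfl
    refine le_trans ?_ this
    rw [← Real.mul_rpow (by positivity) (by positivity)]
    refine Real.rpow_le_rpow (by positivity) ?_ hκ0.le
    rw [← mul_div_assoc]
    gcongr ?_ / _
    calc τ ^ 3 * (#S * e ^ 2) = τ * #S * (τ * e) ^ 2 := by ring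
      _ ≤ _ := by gcongr
  have hM : 0 < (#S * e ^ 2 / Y ^ 34) ^ κ := by positivity
  -- `A` keeps a `1 - 2ρ` share of the target since `3 * κ ≤ 1`; `B`, though tiny, supplies the
  -- missing `2ρ` since `e ^ (28 * κ) ≤ z / 2`.
  have hlarge : ∀ A B : Finset V, A ⊆ S → B ⊆ S → (1 - 2 * ρ) * #S ≤ #A → η ^ 26 * #S ≤ #B →
      (∀ x ∈ A, ∀ y ∈ B, G.Adj x y) → False := by
    intro A B hA hB hAc hBc hAB
    have hAne := hne A _ (by
      have : 0 < 1 - 2 * ρ := by linarith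
      positivity) hAc
    have hBne := hne B _ (by positivity) hBc
    have hd := hdisj A B hAB
    have h1 := hIHS A (1 - 2 * ρ) hA hAne (hproper A B hA hB hBne hd) (by linarith) (by linarith)
      (by
        have h0 : 3 / 4 * e ≤ (1 - 2 * ρ) * e := by gcongr; linarith
        linarith) hAc
    have h2 := ih1 B hB hBne (hproper B A hB hA hAne hd.symm)
    have h3 : (homProd G A : ℝ) + homProd G B ≤ homProd G S := by
      exact_mod_cast homProd_add_le_of_complete G hA hB hAB
    have h4 : 1 - 2 * ρ ≤ ((1 - 2 * ρ) ^ 3) ^ κ := by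
      have h0 : 0 < 1 - 2 * ρ := by linarith
      rw [← Real.rpow_natCast_mul h0.le]
      calc 1 - 2 * ρ = (1 - 2 * ρ) ^ (1 : ℝ) := (Real.rpow_one _).symm
        _ ≤ _ := Real.rpow_le_rpow_of_exponent_ge h0 (by linarith) (by push_cast; linarith)
    have h5 : (#S * e ^ 2 / Y ^ 34) ^ κ ≤ e ^ (28 * κ) * (#B / Y ^ 34 : ℝ) ^ κ := by
      calc (#S * e ^ 2 / Y ^ 34) ^ κ = (e ^ 28 * (η ^ 26 * #S / Y ^ 34)) ^ κ := by
            congr 1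
            have : e ^ 28 * η ^ 26 = e ^ 2 := by
              calc e ^ 28 * η ^ 26 = (η * e) ^ 26 * e ^ 2 := by ring
                _ = _ := by rw [hηe]; ring
            calc _ = e ^ 2 * #S / Y ^ 34 := by ring
              _ = _ := by rw [← this]; ring
        _ ≤ (e ^ 28 * (#B / Y ^ 34)) ^ κ := by gcongr
        _ = _ := by
            rw [Real.mul_rpow (by positivity) (by positivity), ← Real.rpow_natCast_mul he0.le]
            norm_num
    have h6 : e ^ (28 * κ) ≤ z / 2 := by
      have : e ^ (28 * κ) ≤ Y ^ (28 * κ) := Real.rpow_le_rpow he0.le heY (by positivity)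
      linarith
    have h7 : 0 < (#B / Y ^ 34 : ℝ) ^ κ := by
      have : (0 : ℝ) < #B := by exact_mod_cast hBne.card_pos
      positivity
    have h8 : 2 * ρ * (#S * e ^ 2 / Y ^ 34) ^ κ ≤ (#B / Y ^ 34 : ℝ) ^ κ := by
      calc 2 * ρ * (#S * e ^ 2 / Y ^ 34) ^ κ
          ≤ 2 * ρ * (z / 2 * (#B / Y ^ 34 : ℝ) ^ κ) := by
            gcongr
            exact h5.trans (by gcongr)
        _ = (ρ * z) * (#B / Y ^ 34 : ℝ) ^ κ := by ring
        _ = _ := by rw [hρz, one_mul]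
    have h9 := mul_le_mul_of_nonneg_right h4 hM.le
    linarith
  have hSU : S ⊆ U ∪ insert v (nbrsOn Gᶜ S v) := by
    intro x hx
    by_cases h1 : x = v
    · simp [h1]
    by_cases h2 : G.Adj v x
    · exact mem_union_left _ (mem_nbrsOn.2 ⟨hx, h2⟩)
    · refine mem_union_right _ (mem_insert_of_mem (mem_nbrsOn.2 ⟨hx, ?_⟩))
      rw [SimpleGraph.compl_adj]
      exact ⟨fun h => h1 h.symm, h2⟩
  have hSUc : (#S : ℝ) ≤ #U + (#(nbrsOn Gᶜ S v) + 1) := by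
    exact_mod_cast (card_le_card hSU).trans ((card_union_le _ _).trans
      (Nat.add_le_add_left (card_insert_le _ _) _))
  have hv1 := hdeg v hv
  have hanti : ∀ t ∈ S, ∀ A ⊆ S, (∀ x ∈ A, ¬ G.Adj x t) → (#A : ℝ) ≤ η * #S + 1 := by
    intro t ht A hA hAt
    have h1 : A ⊆ insert t (nbrsOn Gᶜ S t) := by
      intro x hx
      by_cases h : x = t
      · simp [h]
      · refine mem_insert_of_mem (mem_nbrsOn.2 ⟨hA hx, ?_⟩)
        rw [SimpleGraph.compl_adj]
        exact ⟨fun h' => h h'.symm, fun h' => hAt x hx h'.symm⟩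
    have h2 : (#A : ℝ) ≤ #(nbrsOn Gᶜ S t) + 1 := by
      exact_mod_cast (card_le_card h1).trans (card_insert_le _ _)
    linarith [hdeg t ht]
  have hCPc := hanti p₀ (hPS hp₀) CP hCPS (fun x hx => (mem_filter.1 hx).2 p₀ hp₀)
  have hmρ : 512 ≤ η * #S := by simpa using hηm 1 (by norm_num)
  by_cases hXc : ρ * #S ≤ #X
  swap
  · push Not at hXc
    exact hlarge Z P hZS hPS (by linarith) hPcard (fun x hx => (mem_filter.1 hx).2)
  set Z₁ := Z.filter (fun x => (∃ k ∈ K, G.Adj x k) ∧ ∃ l ∈ K, ¬ G.Adj x l) with hZ₁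
  have hZ₁S : Z₁ ⊆ S := (filter_subset _ _).trans hZS
  by_cases hZ₁c : ρ * #S ≤ #Z₁
  swap
  -- Nearly every neighbour of `v` is then complete to `K`: the exceptions lie in `Z₁` or are
  -- anticomplete to `P` or `K`, hence few.
  · push Not at hZ₁c
    set A := U.filter (fun x => ∀ k ∈ K, G.Adj x k) with hA
    set CK := U.filter (fun x => ∀ k ∈ K, ¬ G.Adj x k) with hCK
    have hCKc := hanti k₀ (hKS hk₀) CK ((filter_subset _ _).trans hUS)
      (fun x hx => (mem_filter.1 hx).2 k₀ hk₀)
    have hcov : U ⊆ A ∪ (Z₁ ∪ (CP ∪ CK)) := by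
      intro x hx
      have h1 := hUcov hx
      simp only [mem_union] at h1 ⊢
      rcases h1 with h1 | h1 | h1
      · exact Or.inl (mem_filter.2 ⟨hx, hXK x h1⟩)
      · by_cases h2 : ∃ k ∈ K, G.Adj x k
        · by_cases h3 : ∃ l ∈ K, ¬ G.Adj x l
          · exact Or.inr (Or.inl (mem_filter.2 ⟨h1, h2, h3⟩))
          · push Not at h3
            exact Or.inl (mem_filter.2 ⟨hx, h3⟩)
        · push Not at h2
          exact Or.inr (Or.inr (Or.inr (mem_filter.2 ⟨hx, h2⟩)))
      · exact Or.inr (Or.inr (Or.inl h1))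
    have hc : (#U : ℝ) ≤ #A + (#Z₁ + (#CP + #CK)) := by
      exact_mod_cast (card_le_card hcov).trans ((card_union_le _ _).trans
        (Nat.add_le_add_left ((card_union_le _ _).trans
          (Nat.add_le_add_left (card_union_le _ _) _)) _))
    exact hlarge A K ((filter_subset _ _).trans hUS) hKS (by linarith) hKcard
      (fun x hx => (mem_filter.1 hx).2)
  have hXZ : ∀ x ∈ X, ∀ w ∈ Z₁, G.Adj x w := by
    intro x hx w hw
    obtain ⟨-, -, q, hq, hxq⟩ := mem_filter.1 hx
    obtain ⟨hwZ, ⟨k, hk, hwk⟩, l, hl, hwl⟩ := mem_filter.1 hw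
    exact hP.adj_of_mixed_of_mixed hKc hPK hq hxq (hXK x hx) (mem_filter.1 hwZ).2 hk hl hwk hwl
  have hXne := hne X _ (by positivity) hXc
  have hZne := hne Z₁ _ (by positivity) hZ₁c
  have hd := hdisj _ _ hXZ
  have hρe : 1 ≤ ρ * e := by
    rw [hρ, one_div_mul_eq_div, le_div_iff₀ hz0]
    linarith
  have h1 := hIHS X ρ hXS hXne (hproper _ _ hXS hZ₁S hZne hd) hρ0 (by linarith) hρe hXc
  have h2 := hIHS Z₁ ρ hZ₁S hZne (hproper _ _ hZ₁S hXS hXne hd.symm) hρ0 (by linarith) hρe hZ₁c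
  have h3 : (homProd G X : ℝ) + homProd G Z₁ ≤ homProd G S := by
    exact_mod_cast homProd_add_le_of_complete G hXS hZ₁S hXZ
  have h4 : 1 / 2 ≤ (ρ ^ 3) ^ κ := by
    rw [hρ, one_div z, ← Real.rpow_natCast_mul (by positivity), Real.inv_rpow hz0.le,
      one_div]
    gcongr
    refine le_trans (Real.rpow_le_rpow_of_exponent_le (by linarith) ?_) hzκ
    push_cast
    linarith
  have h5 := mul_le_mul_of_nonneg_right h4 hM.le
  linarith

end Recursion

/-! ### From `homProd` to `homNumber`, and the bound for $P_5$ -/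

section HomNumber

theorem homProd_univ_le {n : ℕ} (G : SimpleGraph (Fin n)) :
    homProd G univ ≤ homNumber G ^ 2 := by
  have h : ∀ H : SimpleGraph (Fin n), cliqueNumOn H univ ≤ H.cliqueNum := by
    intro H
    obtain ⟨T, -, hT, h⟩ := exists_cliqueNumOn_eq H univ
    exact h ▸ hT.card_le_cliqueNum
  have h1 := h G
  have h2 := h Gᶜ
  rw [SimpleGraph.cliqueNum_compl] at h2
  rw [sq]
  exact Nat.mul_le_mul (h1.trans (le_max_left _ _)) (h2.trans (le_max_right _ _))

theorem one_le_homNumber {n : ℕ} (hn : 1 ≤ n) (G : SimpleGraph (Fin n)) : 1 ≤ homNumber G := by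
  have h : G.IsClique (({⟨0, hn⟩} : Finset (Fin n)) : Set (Fin n)) := by simp
  have := h.card_le_cliqueNum
  rw [card_singleton] at this
  exact this.trans (le_max_left _ _)

theorem two_le_homNumber {n : ℕ} (hn : 2 ≤ n) (G : SimpleGraph (Fin n)) : 2 ≤ homNumber G := by
  have h : ∀ H : SimpleGraph (Fin n), H.Adj ⟨0, by omega⟩ ⟨1, hn⟩ → 2 ≤ H.cliqueNum := by
    intro H hH
    have hcl : H.IsClique (({⟨0, by omega⟩, ⟨1, hn⟩} : Finset (Fin n)) : Set (Fin n)) := by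
      rw [coe_insert, coe_singleton, SimpleGraph.isClique_pair]
      exact fun _ => hH
    have := hcl.card_le_cliqueNum
    rwa [card_pair (by simp)] at this
  by_cases hG : G.Adj ⟨0, by omega⟩ ⟨1, hn⟩
  · exact (h G hG).trans (le_max_left _ _)
  · have := h Gᶜ (by rw [SimpleGraph.compl_adj]; exact ⟨by simp, hG⟩)
    rw [SimpleGraph.cliqueNum_compl] at this
    exact this.trans (le_max_right _ _)

/-- It suffices to prove the bound for all sufficiently large `n`. -/
theorem hasTwoThirdsBound_of_large {W : Type*} {H : SimpleGraph W} {c L₀ : ℝ} (hc : 0 < c)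
    (hL₀ : 0 ≤ L₀)
    (h : ∀ n : ℕ, L₀ ≤ Real.logb 2 n → ∀ G : SimpleGraph (Fin n), ¬ H.IsIndContained G →
      (2 : ℝ) ^ (c * (Real.logb 2 n) ^ ((2 : ℝ) / 3)) ≤ homNumber G) :
    HasTwoThirdsBound H := by
  have hpos : 0 < L₀ ^ ((2 : ℝ) / 3) + 1 := by positivity
  -- The second term keeps the bound at most 2 when `logb 2 n` is below `L₀`, which any two vertices
  -- achieve.
  refine ⟨min c (1 / (L₀ ^ ((2 : ℝ) / 3) + 1)), lt_min hc (by positivity), ?_⟩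
  intro n hn G hG
  have hlog : 0 ≤ Real.logb 2 n := Real.logb_nonneg (by norm_num) (by exact_mod_cast hn)
  by_cases hL : L₀ ≤ Real.logb 2 n
  · refine le_trans ?_ (h n hL G hG)
    refine Real.rpow_le_rpow_of_exponent_le (by norm_num) ?_
    gcongr
    exact min_le_left _ _
  push Not at hL
  rcases Nat.lt_or_ge n 2 with h2 | h2
  · obtain rfl : n = 1 := by omega
    have := one_le_homNumber hn G
    norm_num
    exact_mod_cast this
  · calc (2 : ℝ) ^ (min c (1 / (L₀ ^ ((2 : ℝ) / 3) + 1)) * (Real.logb 2 n) ^ ((2 : ℝ) / 3))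
        ≤ 2 ^ (1 : ℝ) := by
          refine Real.rpow_le_rpow_of_exponent_le (by norm_num) ?_
          calc _ ≤ 1 / (L₀ ^ ((2 : ℝ) / 3) + 1) * (L₀ ^ ((2 : ℝ) / 3) + 1) := by
                gcongr
                · exact min_le_right _ _
                · have : (Real.logb 2 n) ^ ((2 : ℝ) / 3) ≤ L₀ ^ ((2 : ℝ) / 3) := by gcongr
                  linarith
            _ = 1 := by field_simp
      _ ≤ _ := by
          rw [Real.rpow_one]
          exact_mod_cast two_le_homNumber h2 G

theorem pathFiveFree_of_not_isIndContained {V : Type*} {G : SimpleGraph V}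
    (hG : ¬ (SimpleGraph.pathGraph 5).IsIndContained G) : PathFiveFree G := by
  intro a b c d e hab hbc hcd hde hac had hae hbd hbe hce
  refine hG ?_
  have hadj : ∀ i j : Fin 5, G.Adj (![a, b, c, d, e] i) (![a, b, c, d, e] j) ↔
      (SimpleGraph.pathGraph 5).Adj i j := by
    intro i j
    rw [SimpleGraph.pathGraph_adj]
    fin_cases i <;> fin_cases j <;>
      simp [hab, hbc, hcd, hde, hac, had, hae, hbd, hbe, hce, G.adj_comm b a, G.adj_comm c b,
        G.adj_comm d c, G.adj_comm e d, G.adj_comm c a, G.adj_comm d a, G.adj_comm e a,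
        G.adj_comm d b, G.adj_comm e b, G.adj_comm e c]
  -- `PathFiveFree` does not demand distinct vertices: those of $P_5$ have distinct neighbourhoods,
  -- so adjacency forces injectivity.
  have hinj : Function.Injective ![a, b, c, d, e] := by
    intro i j hij
    have h1 : ∀ k, (SimpleGraph.pathGraph 5).Adj i k ↔ (SimpleGraph.pathGraph 5).Adj j k := by
      intro k
      rw [← hadj i k, ← hadj j k, hij]
    simp only [SimpleGraph.pathGraph_adj] at h1
    revert i j
    have key : ∀ i j : Fin 5, (∀ k : Fin 5, (i.val + 1 = k.val ∨ k.val + 1 = i.val) ↔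
        (j.val + 1 = k.val ∨ k.val + 1 = j.val)) → i = j := by decide
    exact fun i j _ h => key i j h
  exact ⟨⟨⟨_, hinj⟩, hadj _ _⟩⟩

theorem hasTwoThirdsBound_pathGraph_five : HasTwoThirdsBound (SimpleGraph.pathGraph 5) := by
  -- With `t ≥ 68`, `(t ^ 2 - 34 * t) / 100 ≥ t ^ 2 / 200`; passing from `homProd` to `homNumber`
  -- takes a square root, whence 400.
  refine hasTwoThirdsBound_of_large (c := 1 / 400) (L₀ := 68 ^ (3 : ℝ)) (by norm_num)
    (by positivity) ?_
  intro n hL G hG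
  have hP := pathFiveFree_of_not_isIndContained hG
  set L := Real.logb 2 n with hLdef
  obtain ⟨t, ht⟩ : ∃ t, t = L ^ ((1 : ℝ) / 3) := ⟨_, rfl⟩
  have hL0 : 0 < L := lt_of_lt_of_le (by positivity) hL
  have ht68 : 68 ≤ t := by
    rw [ht]
    calc (68 : ℝ) = (68 ^ (3 : ℝ)) ^ ((1 : ℝ) / 3) := by
          rw [← Real.rpow_mul (by norm_num)]; norm_num
      _ ≤ _ := by gcongr
  have ht3 : t ^ 3 = L := by
    rw [ht, ← Real.rpow_natCast, ← Real.rpow_mul hL0.le]; norm_num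
  have ht2 : L ^ ((2 : ℝ) / 3) = t ^ 2 := by
    rw [ht, ← Real.rpow_natCast, ← Real.rpow_mul hL0.le]; norm_num
  have hn0 : 0 < n := by
    rcases Nat.eq_zero_or_pos n with h | h
    · subst h; simp [hLdef] at hL0
    · exact h
  have hnL : (n : ℝ) = 2 ^ L := by
    rw [hLdef, Real.rpow_logb (by norm_num) (by norm_num) (by exact_mod_cast hn0)]
  have h2 : (1 : ℝ) ≤ 2 := by norm_num
  have ht0 : 0 < t := by linarith
  rw [ht2]
  by_cases hcl : ∀ T : Finset (Fin n), G.IsClique (T : Set (Fin n)) →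
      (#T : ℝ) < (2 : ℝ) ^ (t ^ 2) / 2
  · have hκt : t * (1 / (100 * t)) = 1 / 100 := by field_simp
    have key := hP.rpow_le_homProd (z := 2 ^ t) (Y := 2 ^ (t ^ 2)) (κ := 1 / (100 * t))
      (by
        calc (8 : ℝ) = 2 ^ (3 : ℝ) := by norm_num
          _ ≤ _ := Real.rpow_le_rpow_of_exponent_le h2 (by linarith))
      (by
        rw [← Real.rpow_mul_natCast (by norm_num)]
        refine Real.rpow_le_rpow_of_exponent_le h2 ?_
        push_cast
        nlinarith)
      (by positivity)
      (by gcongr; linarith)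
      (by
        rw [← Real.rpow_mul (by norm_num)]
        calc (2 : ℝ) ^ (t * (87 * (1 / (100 * t)))) ≤ 2 ^ (1 : ℝ) := by
              refine Real.rpow_le_rpow_of_exponent_le h2 ?_
              linarith
          _ = 2 := Real.rpow_one _)
      (by
        rw [← Real.rpow_mul (by norm_num)]
        calc (2 : ℝ) * 2 ^ (t ^ 2 * (28 * (1 / (100 * t)))) =
              2 ^ (1 + t ^ 2 * (28 * (1 / (100 * t)))) := by
                rw [Real.rpow_add (by norm_num), Real.rpow_one]
          _ ≤ _ := by
              refine Real.rpow_le_rpow_of_exponent_le h2 ?_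
              have : t ^ 2 * (28 * (1 / (100 * t))) = 28 / 100 * t := by field_simp
              linarith)
      hcl univ ⟨⟨0, hn0⟩, mem_univ _⟩ 1 le_rfl
      (one_le_pow₀ (Real.one_le_rpow h2 (by positivity)))
      (fun v _ => by
        rw [one_mul]; exact_mod_cast card_le_card (nbrsOn_subset _ _ _))
    rw [card_univ, Fintype.card_fin, hnL, one_pow, mul_one, ← Real.rpow_mul_natCast (by norm_num),
      ← Real.rpow_sub (by norm_num), ← Real.rpow_mul (by norm_num)] at key
    have h3 : (homProd G univ : ℝ) ≤ (homNumber G : ℝ) ^ 2 := by exact_mod_cast homProd_univ_le G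
    have h4 : ((2 : ℝ) ^ (1 / 400 * t ^ 2)) ^ 2 ≤ (homNumber G : ℝ) ^ 2 := by
      refine le_trans ?_ (key.trans h3)
      rw [← Real.rpow_mul_natCast (by norm_num)]
      refine Real.rpow_le_rpow_of_exponent_le h2 ?_
      rw [← ht3]
      have : (t ^ 3 - t ^ 2 * (34 : ℕ)) * (1 / (100 * t)) = (t ^ 2 - 34 * t) / 100 := by
        push_cast; field_simp
      rw [this]
      push_cast
      nlinarith
    exact le_of_sq_le_sq h4 (by positivity)
  · push Not at hcl
    obtain ⟨T, hT, hTc⟩ := hcl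
    have h3 : (#T : ℝ) ≤ homNumber G := by
      exact_mod_cast hT.card_le_cliqueNum.trans (le_max_left _ _)
    refine le_trans ?_ (hTc.trans h3)
    calc (2 : ℝ) ^ (1 / 400 * t ^ 2) ≤ 2 ^ (t ^ 2 - 1) :=
          Real.rpow_le_rpow_of_exponent_le h2 (by nlinarith)
      _ = _ := by rw [Real.rpow_sub (by norm_num), Real.rpow_one]

end HomNumber

/-! ### Substitution preserves the bound -/

section Substitution

theorem cliqueNum_le_of_embedding {V W : Type*} [Finite W] {G : SimpleGraph V}
    {G' : SimpleGraph W} (f : G ↪g G') : G.cliqueNum ≤ G'.cliqueNum := by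
  obtain ⟨T, hT⟩ := G.exists_isNClique_cliqueNum
  have hcl : G'.IsClique ((T.map f.toEmbedding : Finset W) : Set W) := by
    intro x hx y hy hxy
    simp only [coe_map, Set.mem_image, mem_coe] at hx hy
    obtain ⟨a, ha, rfl⟩ := hx
    obtain ⟨b, hb, rfl⟩ := hy
    exact f.map_rel_iff.2 (hT.isClique ha hb (fun h => hxy (h ▸ rfl)))
  have := hcl.card_le_cliqueNum
  rwa [card_map, hT.card_eq] at this

theorem homNumber_le_of_embedding {V W : Type*} [Finite W] {G : SimpleGraph V}
    {G' : SimpleGraph W} (f : G ↪g G') : homNumber G ≤ homNumber G' := by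
  have h := cliqueNum_le_of_embedding (SimpleGraph.Embedding.complEquiv f)
  rw [SimpleGraph.cliqueNum_compl, SimpleGraph.cliqueNum_compl] at h
  exact max_le_max (cliqueNum_le_of_embedding f) h

/-- A bound for `H`-free graphs applies to every set of vertices that contains no copy of `H`. -/
theorem HomBound.exists_embedding_or_le {V : Type*} {H : SimpleGraph V} {g : ℕ → ℝ}
    (h : HomBound H g) {n : ℕ} (G : SimpleGraph (Fin n)) (S : Finset (Fin n)) (hS : 1 ≤ #S) :
    (∃ f : H ↪g G, ∀ u, f u ∈ S) ∨ g #S ≤ homNumber G := by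
  let φ : Fin #S ↪ Fin n := S.equivFin.symm.toEmbedding.trans (Function.Embedding.subtype _)
  let e : G.comap φ ↪g G := SimpleGraph.Embedding.comap φ G
  by_cases hH : H.IsIndContained (G.comap φ)
  · obtain ⟨f⟩ := hH
    exact Or.inl ⟨f.trans e, fun u => (S.equivFin.symm (f u)).2⟩
  · refine Or.inr ((h #S hS _ hH).trans ?_)
    exact_mod_cast homNumber_le_of_embedding e

/-- If every `m`-subset contains a member of a family of `h`-subsets then the family is large. -/
theorem choose_le_card_mul_choose {α : Type*} [Fintype α] [DecidableEq α] {m h : ℕ}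
    (hhm : h ≤ m) (hm : m ≤ Fintype.card α) (F : Finset (Finset α)) (hF : ∀ E ∈ F, #E = h)
    (hcov : ∀ T : Finset α, #T = m → ∃ E ∈ F, E ⊆ T) :
    (Fintype.card α).choose h ≤ #F * m.choose h := by
  set n := Fintype.card α with hn
  have h1 : n.choose m ≤ #F * (n - h).choose (m - h) := by
    have hsub : powersetCard m (univ : Finset α) ⊆
        F.biUnion (fun E => (powersetCard m univ).filter (fun T => E ⊆ T)) := by
      intro T hT
      obtain ⟨E, hE, hET⟩ := hcov T (mem_powersetCard.1 hT).2
      exact mem_biUnion.2 ⟨E, hE, mem_filter.2 ⟨hT, hET⟩⟩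
    have h2 := card_le_card hsub
    rw [card_powersetCard, card_univ] at h2
    refine h2.trans (card_biUnion_le_card_mul _ _ _ fun E hE => ?_)
    have h3 : #(powersetCard (m - h) (univ \ E)) = (n - h).choose (m - h) := by
      rw [card_powersetCard, card_sdiff_of_subset (subset_univ _), card_univ, hF E hE]
    rw [← h3]
    refine card_le_card_of_injOn (fun T => T \ E) ?_ ?_
    · intro T hT
      simp only [coe_filter, Set.mem_ofPred_eq, mem_powersetCard] at hT
      simp only [mem_powersetCard, mem_coe]
      refine ⟨sdiff_subset_sdiff (subset_univ _) subset_rfl, ?_⟩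
      rw [card_sdiff_of_subset hT.2, hT.1.2, hF E hE]
    · intro T hT T' hT' heq
      simp only [coe_filter, Set.mem_ofPred_eq] at hT hT'
      simp only at heq
      rw [← sdiff_union_of_subset hT.2, ← sdiff_union_of_subset hT'.2, heq]
  have h4 := Nat.choose_mul (n := n) hhm
  have hpos : 0 < (n - h).choose (m - h) := Nat.choose_pos (by omega)
  refine Nat.le_of_mul_le_mul_right ?_ hpos
  calc n.choose h * (n - h).choose (m - h) = n.choose m * m.choose h := h4.symm
    _ ≤ #F * (n - h).choose (m - h) * m.choose h := Nat.mul_le_mul_right _ h1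
    _ = _ := by ring

/-- If every `m`-set of vertices contains a copy of `H` then some partial copy of `H` missing only
`v` extends in many ways. -/
theorem exists_many_extensions {V : Type*} [Fintype V] {n m : ℕ}
    (H : SimpleGraph V) (v : V) (G : SimpleGraph (Fin n)) (hhm : Fintype.card V ≤ m) (hm : m ≤ n)
    (hcov : ∀ T : Finset (Fin n), #T = m → ∃ f : H ↪g G, ∀ u, f u ∈ T) :
    ∃ (p : {u : V // u ≠ v} → Fin n) (X : Finset (Fin n)),
      (∀ x ∈ X, ∃ f : H ↪g G, f v = x ∧ ∀ u : {u : V // u ≠ v}, f u = p u) ∧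
      n.choose (Fintype.card V) ≤ #X * n ^ (Fintype.card V - 1) * m.choose (Fintype.card V) := by
  classical
  have : Finite (H ↪g G) := Finite.of_injective (fun f => (f : V → Fin n)) DFunLike.coe_injective
  let _ : Fintype (H ↪g G) := Fintype.ofFinite _
  have h1 := choose_le_card_mul_choose (α := Fin n) hhm (by simpa using hm)
    (univ.image (fun f : H ↪g G => univ.map f.toEmbedding))
    (fun E hE => by
      obtain ⟨f, -, rfl⟩ := mem_image.1 hE
      rw [card_map, card_univ])
    (fun T hT => by
      obtain ⟨f, hf⟩ := hcov T hT
      refine ⟨_, mem_image_of_mem _ (mem_univ f), fun x hx => ?_⟩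
      obtain ⟨u, -, rfl⟩ := mem_map.1 hx
      exact hf u)
  rw [Fintype.card_fin] at h1
  let r : (H ↪g G) → ({u : V // u ≠ v} → Fin n) := fun f u => f u
  have hne : (univ : Finset ({u : V // u ≠ v} → Fin n)).Nonempty := by
    rw [univ_nonempty_iff]
    have : 0 < n := lt_of_lt_of_le (Fintype.card_pos_iff.2 ⟨v⟩) (hhm.trans hm)
    exact ⟨fun _ => ⟨0, this⟩⟩
  obtain ⟨p, -, hp⟩ := exists_max_image univ
    (fun p => #((univ : Finset (H ↪g G)).filter (fun f => r f = p))) hne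
  refine ⟨p, (univ.filter (fun f => r f = p)).image (fun f => f v), ?_, ?_⟩
  · intro x hx
    obtain ⟨f, hf, rfl⟩ := mem_image.1 hx
    exact ⟨f, rfl, fun u => congrFun (mem_filter.1 hf).2 u⟩
  -- Copies with the same restriction `p` differ only in the image of `v`, so the most popular of
  -- the at most `n ^ (h - 1)` restrictions gives the set `X`, where `h` is the order of `H`.
  · have h2 : #((univ.filter (fun f => r f = p)).image (fun f : H ↪g G => f v)) =
        #(univ.filter (fun f => r f = p)) := by
      refine card_image_of_injOn ?_
      intro f hf g hg hfg
      simp only [coe_filter, Set.mem_ofPred_eq, mem_univ, true_and] at hf hg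
      ext u
      by_cases hu : u = v
      · subst hu
        exact congrArg Fin.val hfg
      · have := congrFun (hf.trans hg.symm) ⟨u, hu⟩
        exact congrArg Fin.val this
    have h3 : Fintype.card (H ↪g G) ≤ #(univ.filter (fun f => r f = p)) *
        n ^ (Fintype.card V - 1) := by
      rw [← card_univ (α := H ↪g G),
        card_eq_sum_card_fiberwise (f := r) (t := univ) (fun _ _ => by simp)]
      refine (sum_le_card_nsmul _ _ _ fun q _ => hp q (mem_univ _)).trans (le_of_eq ?_)
      rw [card_univ, Fintype.card_fun, Fintype.card_fin, smul_eq_mul, mul_comm,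
        Fintype.card_subtype_compl, Fintype.card_subtype_eq]
    rw [h2]
    refine h1.trans (Nat.mul_le_mul_right _ (le_trans ?_ h3))
    exact card_image_le.trans (by rw [card_univ])

/-- Every vertex of `X` can play `v` beside the same partial copy `p`, so a copy of `F` inside `X`
can replace it. -/
theorem substGraph_isIndContained {V W : Type*} {n : ℕ} {H : SimpleGraph V} {v : V}
    {F : SimpleGraph W} {G : SimpleGraph (Fin n)} {p : {u : V // u ≠ v} → Fin n}
    {X : Finset (Fin n)} (hXne : X.Nonempty)
    (hX : ∀ x ∈ X, ∃ f : H ↪g G, f v = x ∧ ∀ u : {u : V // u ≠ v}, f u = p u)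
    (g : F ↪g G) (hg : ∀ w, g w ∈ X) : (substGraph H v F).IsIndContained G := by
  have hpv : ∀ a w, p a ≠ g w := by
    intro a w h
    obtain ⟨f, hfv, hf⟩ := hX _ (hg w)
    rw [← hfv, ← hf a] at h
    exact a.2 (f.injective h)
  have hadj : ∀ a w, G.Adj (p a) (g w) ↔ H.Adj a v := by
    intro a w
    obtain ⟨f, hfv, hf⟩ := hX _ (hg w)
    rw [← hfv, ← hf a]
    exact f.map_rel_iff
  obtain ⟨x₀, hx₀⟩ := hXne
  obtain ⟨f₀, -, hf₀⟩ := hX x₀ hx₀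
  have hinj : Function.Injective (Sum.elim p g) := by
    rintro (a | w) (b | w') h
    · simp only [Sum.elim_inl, ← hf₀] at h
      exact congrArg Sum.inl (Subtype.ext (f₀.injective h))
    · exact absurd h (hpv a w')
    · exact absurd h.symm (hpv b w)
    · exact congrArg Sum.inr (g.injective h)
  refine ⟨⟨⟨Sum.elim p g, hinj⟩, ?_⟩⟩
  rintro (a | w) (b | w')
  · change G.Adj (p a) (p b) ↔ H.Adj a b
    rw [← hf₀, ← hf₀]
    exact f₀.map_rel_iff
  · exact hadj a w'
  · exact (G.adj_comm _ _).trans ((hadj b w).trans (H.adj_comm _ _))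
  · exact g.map_rel_iff

theorem le_card_of_choose_le {n m h x : ℕ} (hh : 1 ≤ h) (hn : 2 * h ≤ n)
    (hx : n.choose h ≤ x * n ^ (h - 1) * m.choose h) : (n : ℝ) ≤ x * (2 * m) ^ h := by
  have hn0 : (0 : ℝ) < n := by
    have : 0 < n := by omega
    exact_mod_cast this
  have hf : (0 : ℝ) < h.factorial := by exact_mod_cast h.factorial_pos
  have h1 : (((n + 1 - h : ℕ) ^ h : ℕ) : ℝ) / h.factorial ≤ n.choose h := by
    exact_mod_cast Nat.pow_le_choose (α := ℝ) h n
  have h2 : (m.choose h : ℝ) ≤ (m : ℝ) ^ h / h.factorial := Nat.choose_le_pow_div h m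
  have h3 : (n.choose h : ℝ) ≤ x * (n : ℝ) ^ (h - 1) * m.choose h := by exact_mod_cast hx
  have h4 : (n : ℝ) / 2 ≤ (n + 1 - h : ℕ) := by
    have : n ≤ 2 * (n + 1 - h) := by omega
    have : (n : ℝ) ≤ 2 * (n + 1 - h : ℕ) := by exact_mod_cast this
    linarith
  have h5 : ((n : ℝ) / 2) ^ h / h.factorial ≤
      x * (n : ℝ) ^ (h - 1) * ((m : ℝ) ^ h / h.factorial) := by
    calc _ ≤ (((n + 1 - h : ℕ) ^ h : ℕ) : ℝ) / h.factorial := by push_cast; gcongr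
      _ ≤ _ := h1.trans (h3.trans (by gcongr))
  have h6 : ((n : ℝ) / 2) ^ h ≤ x * (n : ℝ) ^ (h - 1) * (m : ℝ) ^ h := by
    rw [← mul_div_assoc] at h5
    exact (div_le_div_iff_of_pos_right hf).1 h5
  have h7 : (n : ℝ) ^ h = n * (n : ℝ) ^ (h - 1) := by
    rw [← pow_succ', Nat.sub_add_cancel hh]
  rw [div_pow, div_le_iff₀ (by positivity), h7] at h6
  refine le_of_mul_le_mul_right (a := (n : ℝ) ^ (h - 1)) (h6.trans (le_of_eq ?_)) (by positivity)
  rw [mul_pow]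
  ring

/-- Take `w = n ^ (1 / (4 * h))` with `h` the order of `H`, and `m` about `w ^ 2 / 2`. If each
`m`-set contains `H`, then `#X ≥ n / (2 * m) ^ h ≥ w ^ (2 * h)`. Both `m` and `#X` are at least `w`,
whose logarithm is a constant fraction of that of `n`. -/
theorem HasTwoThirdsBound.substGraph {V W : Type*} [Finite V] {H : SimpleGraph V} (v : V)
    {F : SimpleGraph W} (hH : HasTwoThirdsBound H) (hF : HasTwoThirdsBound F) :
    HasTwoThirdsBound (substGraph H v F) := by
  classical
  let _ : Fintype V := Fintype.ofFinite V
  obtain ⟨c₁, hc₁, hH⟩ := hH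
  obtain ⟨c₂, hc₂, hF⟩ := hF
  obtain ⟨h, hh⟩ : ∃ h, h = Fintype.card V := ⟨_, rfl⟩
  have hh1 : 1 ≤ h := hh ▸ Fintype.card_pos_iff.2 ⟨v⟩
  have hh1' : (1 : ℝ) ≤ h := by exact_mod_cast hh1
  have hh0 : (0 : ℝ) < h := by linarith
  have h2 : (1 : ℝ) ≤ 2 := by norm_num
  refine hasTwoThirdsBound_of_large (c := min c₁ c₂ * (1 / (4 * h)) ^ ((2 : ℝ) / 3))
    (L₀ := 4 * h * Real.logb 2 (4 + 2 * h))
    (mul_pos (lt_min hc₁ hc₂) (by positivity))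
    (mul_nonneg (by positivity) (Real.logb_nonneg (by norm_num) (by linarith))) ?_
  intro n hL G hG
  have hlog0 : 0 < Real.logb 2 (4 + 2 * h) := Real.logb_pos (by norm_num) (by linarith)
  set L := Real.logb 2 n with hLdef
  have hL0 : 0 < L := lt_of_lt_of_le (by positivity) hL
  have hn0 : 0 < n := by
    rcases Nat.eq_zero_or_pos n with h | h
    · subst h; simp [hLdef] at hL0
    · exact h
  have hn0' : (0 : ℝ) < n := by exact_mod_cast hn0
  have hnL : (2 : ℝ) ^ L = n := Real.rpow_logb (by norm_num) (by norm_num) hn0'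
  obtain ⟨w, hw⟩ : ∃ w, w = (2 : ℝ) ^ (L / (4 * h)) := ⟨_, rfl⟩
  have hwl : 4 + 2 * (h : ℝ) ≤ w := by
    rw [← Real.rpow_logb (b := 2) (x := 4 + 2 * (h : ℝ)) (by norm_num) (by norm_num)
      (by positivity), hw]
    refine Real.rpow_le_rpow_of_exponent_le h2 ?_
    rw [le_div_iff₀ (by positivity)]
    linarith
  have hw0 : 0 < w := by linarith
  have hwn : w ^ (4 * h) = n := by
    rw [hw, ← Real.rpow_mul_natCast (by norm_num), ← hnL]
    congr 1
    push_cast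
    field_simp
  have hwn2 : w ^ 2 ≤ n := by
    rw [← hwn]
    exact pow_le_pow_right₀ (by linarith) (by omega)
  obtain ⟨m, hm⟩ : ∃ m : ℕ, m = ⌊w ^ 2 / 2⌋₊ := ⟨_, rfl⟩
  have hm2 : (m : ℝ) ≤ w ^ 2 / 2 := hm ▸ Nat.floor_le (by positivity)
  have hwm : w ≤ m := by
    have := Nat.lt_floor_add_one (w ^ 2 / 2)
    rw [← hm] at this
    nlinarith
  have hmono : ∀ c : ℝ, ∀ x : ℝ, min c₁ c₂ ≤ c → w ≤ x →
      (2 : ℝ) ^ (min c₁ c₂ * (1 / (4 * h)) ^ ((2 : ℝ) / 3) * L ^ ((2 : ℝ) / 3)) ≤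
        2 ^ (c * (Real.logb 2 x) ^ ((2 : ℝ) / 3)) := by
    intro c x hc hx
    refine Real.rpow_le_rpow_of_exponent_le h2 ?_
    rw [mul_assoc, ← Real.mul_rpow (by positivity) hL0.le, one_div_mul_eq_div]
    have h3 : L / (4 * h) ≤ Real.logb 2 x := by
      have : L / (4 * h) = Real.logb 2 w := by
        rw [hw, Real.logb_rpow (by norm_num) (by norm_num)]
      rw [this]
      exact Real.logb_le_logb_of_le (by norm_num) hw0 hx
    have h4 : 0 < min c₁ c₂ := lt_min hc₁ hc₂
    have h5 : 0 ≤ c := h4.le.trans hc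
    gcongr
  by_contra hcon
  push Not at hcon
  have hhm : h ≤ m := by
    have : (h : ℝ) ≤ m := by linarith
    exact_mod_cast this
  have hmn : m ≤ n := by
    have : (m : ℝ) ≤ n := by linarith [sq_nonneg w]
    exact_mod_cast this
  have hcov : ∀ T : Finset (Fin n), #T = m → ∃ f : H ↪g G, ∀ u, f u ∈ T := by
    intro T hT
    rcases hH.exists_embedding_or_le G T (by omega) with h3 | h3
    · exact h3
    · rw [hT] at h3
      exact absurd ((hmono c₁ m (min_le_left _ _) hwm).trans h3) (not_le.2 hcon)
  obtain ⟨p, X, hX, hcard⟩ := exists_many_extensions H v G (hh ▸ hhm) hmn hcov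
  rw [← hh] at hcard
  have h2hn : 2 * h ≤ n := by
    have : 2 * (h : ℝ) ≤ n := by nlinarith
    exact_mod_cast this
  have hXn := le_card_of_choose_le hh1 h2hn hcard
  have hXw : w ≤ #X := by
    have h5 : (2 * (m : ℝ)) ^ h ≤ w ^ (2 * h) := by
      rw [pow_mul]
      gcongr
      linarith
    have h6 : w ^ (2 * h) * w ^ (2 * h) ≤ #X * w ^ (2 * h) := by
      calc _ = (n : ℝ) := by rw [← hwn, ← pow_add]; congr 1; ring
        _ ≤ #X * w ^ (2 * h) := hXn.trans (by gcongr)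
    have h7 := le_of_mul_le_mul_right h6 (by positivity)
    refine le_trans ?_ h7
    exact le_self_pow₀ (by linarith) (by omega)
  have hX1 : 1 ≤ #X := by
    have : (1 : ℝ) ≤ #X := by linarith
    exact_mod_cast this
  rcases hF.exists_embedding_or_le G X hX1 with ⟨g, hg⟩ | h3
  · exact hG (substGraph_isIndContained (card_pos.1 hX1) hX g hg)
  · exact absurd ((hmono c₂ _ (min_le_right _ _) hXw).trans h3) (not_le.2 hcon)

end Substitution

/-! ### Induction over the class, and infinitely many orders -/

section IteratedSubstitution

theorem IsErdosHajnal.hasTwoThirdsBound {V : Type*} {H : SimpleGraph V} (hH : IsErdosHajnal H) :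
    HasTwoThirdsBound H := by
  obtain ⟨ε, hε, hH⟩ := hH
  refine hasTwoThirdsBound_of_large (c := ε) (L₀ := 1) hε zero_le_one ?_
  intro n hL G hG
  have hn0 : 0 < n := by
    rcases Nat.eq_zero_or_pos n with h | h
    · subst h; norm_num at hL
    · exact h
  refine le_trans ?_ (hH n hn0 G hG)
  calc (2 : ℝ) ^ (ε * (Real.logb 2 n) ^ ((2 : ℝ) / 3)) ≤ 2 ^ (ε * (Real.logb 2 n) ^ (1 : ℝ)) := by
        refine Real.rpow_le_rpow_of_exponent_le (by norm_num) ?_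
        gcongr
        norm_num
    _ = (n : ℝ) ^ ε := by
        rw [Real.rpow_one, mul_comm, Real.rpow_mul (by norm_num),
          Real.rpow_logb (by norm_num) (by norm_num) (by exact_mod_cast hn0)]

theorem HasTwoThirdsBound.iso {V W : Type*} {H : SimpleGraph V} {H' : SimpleGraph W}
    (hH : HasTwoThirdsBound H) (e : H ≃g H') : HasTwoThirdsBound H' := by
  obtain ⟨c, hc, hH⟩ := hH
  refine ⟨c, hc, fun n hn G hG => hH n hn G fun h => hG ?_⟩
  obtain ⟨f⟩ := h
  exact ⟨e.symm.toEmbedding.trans f⟩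

/-- Counting copies of the outer graph of a substitution requires it to be finite. -/
theorem IteratedSubst.finite {V : Type} {H : SimpleGraph V} (h : IteratedSubst H) : Finite V := by
  induction h with
  | path => infer_instance
  | erdosHajnal H _ => assumption
  | subst H v F _ _ ih₁ ih₂ => infer_instance
  | iso H H' _ e ih =>
    obtain ⟨e⟩ := e
    exact Finite.of_equiv _ e.toEquiv

theorem IteratedSubst.hasTwoThirdsBound {V : Type} {H : SimpleGraph V} (h : IteratedSubst H) :
    HasTwoThirdsBound H := by
  induction h with
  | path => exact hasTwoThirdsBound_pathGraph_five
  | erdosHajnal H h => exact h.hasTwoThirdsBound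
  | subst H v F h₁ _ ih₁ ih₂ =>
    have := h₁.finite
    exact ih₁.substGraph v ih₂
  | iso H H' _ e ih =>
    obtain ⟨e⟩ := e
    exact ih.iso e

theorem isIndContained_substGraph {V W : Type*} (H : SimpleGraph V) (v : V) (F : SimpleGraph W) :
    F.IsIndContained (substGraph H v F) :=
  ⟨⟨⟨Sum.inr, Sum.inr_injective⟩, Iff.rfl⟩⟩

/-- Substituting the previous graph for an end vertex of $P_5$ adds four vertices and keeps that
graph induced. -/
theorem exists_iteratedSubst_card (k : ℕ) : ∃ H : SimpleGraph (Fin (5 + 4 * k)),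
    IteratedSubst H ∧ (SimpleGraph.pathGraph 5).IsIndContained H := by
  induction k with
  | zero => exact ⟨SimpleGraph.pathGraph 5, .path, .refl _⟩
  | succ k ih =>
    obtain ⟨H, hH, hP⟩ := ih
    have hcard : Fintype.card ({u : Fin 5 // u ≠ 0} ⊕ Fin (5 + 4 * k)) =
        Fintype.card (Fin (5 + 4 * (k + 1))) := by
      rw [Fintype.card_sum, Fintype.card_subtype_compl, Fintype.card_subtype_eq]
      simp only [Fintype.card_fin]
      omega
    let e := Fintype.equivOfCardEq hcard
    let K := substGraph (SimpleGraph.pathGraph 5) 0 H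
    refine ⟨K.map e.toEmbedding, .iso K _ (.subst _ 0 H .path hH) ⟨SimpleGraph.Iso.map e K⟩, ?_⟩
    exact (hP.trans (isIndContained_substGraph _ 0 H)).trans
      ⟨(SimpleGraph.Iso.map e K).toEmbedding⟩

end IteratedSubstitution

theorem mainTheorem5 :
    (∀ (V : Type) (H : SimpleGraph V), IteratedSubst H → HasTwoThirdsBound H) ∧
    {m : ℕ | ∃ H : SimpleGraph (Fin m), IteratedSubst H ∧
      (SimpleGraph.pathGraph 5).IsIndContained H ∧ HasTwoThirdsBound H}.Infinite := by
  refine ⟨fun V H h => h.hasTwoThirdsBound, ?_⟩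
  refine Set.infinite_of_injective_forall_mem (f := fun k : ℕ => 5 + 4 * k)
    (fun a b h => by simp only at h; omega) fun k => ?_
  obtain ⟨H, hH, hP⟩ := exists_iteratedSubst_card k
  exact ⟨H, hH, hP, hH.hasTwoThirdsBound⟩
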